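/- Let $W$ be the principal branch of the Lambert function (so $W(x)e^{W(x)}=x$ for $x\ge 0$). For $\sigma>1$ and $\rho>0$ put $\omega_\sigma(0)=0$, $\omega_\sigma(x)=x^{\frac{\sigma}{\sigma-1}}/W(x)^{\frac1{\sigma-1}}$ for $x>0$, $g_\sigma(x)=\omega_\sigma(\ln(1+|x|))$ for $x\in\mathbb R$, and $f_{\rho,\sigma}(x)=e^{-\rho g_\sigma(1/x)}$ for $x\ne 0$, $f_{\rho,\sigma}(0)=0$. A continuous function $F:\mathbb R\to\mathbb C$ belongs to $\mathbf\Gamma_\sigma$ if there are $\rho,C>0$ with $|F(\xi)|\le Ce^{-\rho g_\sigma(\xi)}$ for all $\xi\in\mathbb R$. A smooth function $f:\mathbb R\to\mathbb C$ belongs to $\mathcal E_\sigma$ if there is $\tau>0$ such that for every compact $K\subset\mathbb R$ there is $C>0$ with $\sup_{x\in K}|f^{(p)}(x)|\le C^{p^\sigma+1}M_p$ for all integers $p\ge 0$, where $M_0=1$ and $M_p=p^{\tau p^\sigma}$ for $p\ge1$. An element of $L^2(\mathbb R)$ is said to lie in $\mathbf\Gamma_\sigma$ or $\mathcal E_\sigma$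 if it has a continuous, respectively smooth, representative that does. **Theorem 3.2.** Let $\sigma>1$. Let $m_0:\mathbb R\to\mathbb R$ be a (real-valued) continuous, even, $2\pi$-periodic function with $m_0(0)=1$, $\inf_{|\xi|\le\pi/3}|m_0(\xi)|\neq0$ and $|m_0(\xi)|^2+|m_0(\xi+\pi)|^2=1$ for all $\xi\in\mathbb R$, such that $$\{\xi: m_0(\xi)\ne0\}\cap[0,\pi]\subset[0,\tfrac{4\pi}5).$$ Let $\varphi\in L^2(\mathbb R)$ be the associated scaling function, that is, $\widehat\varphi(\xi)=\prod_{j=1}^\infty m_0(2^{-j}\xi)$, where $\widehat\varphi(\xi)=\int\varphi(x)e^{-ix\xi}\,dx$ (in the sense of Plancherel). Suppose that there are constants $\varepsilon,C_0,C_1,\rho_0,\rho_1>0$ with $$C_1 f_{\rho_1,\sigma}\big(\xi-\tfrac{2\pi}3\big)\le|m_0(\xi)|\le C_0 f_{\rho_0,\sigma}\big(\xi-\tfrac{2\pi}3\big),\qquad \xi\in\big[\tfrac{2\pi}3-\varepsilon,\tfrac{2\pi}3+\varepsilon\big].$$ Then for every $\eta>1$, with $$\sigma_\eta=\frac{\sigma+\eta(\sigma-1)}{1+\eta(\sigma-1)},$$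 one has $\sigma_\eta\in(1,\min\{2,\sigma\})$, $$\widehat\varphi\in\mathbf\Gamma_\sigma\setminus\bigcup_{1<\sigma'<\sigma_\eta}\mathbf\Gamma_{\sigma'}\qquad\text{and}\qquad \varphi\in\mathcal E_\sigma\setminus\bigcup_{1<\sigma'<\sigma_\eta}\mathcal E_{\sigma'}.$$ -/

import Mathlib

open Real Set MeasureTheory
open scoped ENNReal FourierTransform ContDiff

noncomputable section

namespace LowPass

/-- The real principal branch of the Lambert function, i.e. the inverse of `y ↦ y * exp y` on
`[-1, ∞)`. It is only used at arguments `x ≥ 0`. -/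
def lambertW (x : ℝ) : ℝ :=
  Function.invFunOn (fun y : ℝ => y * Real.exp y) (Set.Ici (-1)) x

/-- `ω_σ(x) = x^{σ/(σ-1)} / W(x)^{1/(σ-1)}` for `x > 0`; the value at `0` is `0`. -/
def omega (σ x : ℝ) : ℝ :=
  if x = 0 then 0 else x ^ (σ / (σ - 1)) / lambertW x ^ (1 / (σ - 1))

/-- `g_σ(x) = ω_σ(log(1 + |x|))`. -/
def gfun (σ x : ℝ) : ℝ := omega σ (Real.log (1 + |x|))

/-- `f_{ρ,σ}(x) = exp(-ρ g_σ(1/x))` for `x ≠ 0`, extended by its limit `0` to `x = 0`. -/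
def ffun (ρ σ x : ℝ) : ℝ := if x = 0 then 0 else Real.exp (-ρ * gfun σ (1 / x))

/-- The decay class `Γ_σ(ℝ)`. -/
def MemGamma (σ : ℝ) (F : ℝ → ℂ) : Prop :=
  Continuous F ∧ ∃ ρ > 0, ∃ C > 0, ∀ ξ : ℝ, ‖F ξ‖ ≤ C * Real.exp (-ρ * gfun σ ξ)

/-- `M_p^{τ,σ} = p^{τ p^σ}` for `p ≥ 1` and `M_0^{τ,σ} = 1`. -/
def gevreySeq (τ σ : ℝ) (p : ℕ) : ℝ := if p = 0 then 1 else (p : ℝ) ^ (τ * (p : ℝ) ^ σ)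

/-- The class `ℰ_{τ,σ}(ℝ)`. -/
def MemExtGevreyTau (τ σ : ℝ) (f : ℝ → ℂ) : Prop :=
  ContDiff ℝ ∞ f ∧ ∀ K : Set ℝ, IsCompact K → ∃ C > 0, ∀ p : ℕ, ∀ x ∈ K,
    ‖iteratedDeriv p f x‖ ≤ C ^ ((p : ℝ) ^ σ + 1) * gevreySeq τ σ p

/-- The extended Gevrey class `ℰ_σ(ℝ)`, the union of the `ℰ_{τ,σ}(ℝ)` over `τ > 0`. -/
def MemExtGevrey (σ : ℝ) (f : ℝ → ℂ) : Prop := ∃ τ > 0, MemExtGevreyTau τ σ f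

/-- A function given up to null sets belongs to `Γ_σ(ℝ)` if it has a (necessarily unique)
continuous representative that does. -/
def AEMemGamma (σ : ℝ) (F : ℝ → ℂ) : Prop := ∃ G : ℝ → ℂ, F =ᵐ[volume] G ∧ MemGamma σ G

/-- A function given up to null sets belongs to `ℰ_σ(ℝ)` if it has a (necessarily unique)
smooth representative that does. -/
def AEMemExtGevrey (σ : ℝ) (f : ℝ → ℂ) : Prop :=
  ∃ h : ℝ → ℂ, f =ᵐ[volume] h ∧ MemExtGevrey σ h

/-- Low-pass filters: continuous, even, `2π`-periodic, with `m₀(0) = 1`, bounded away from zero on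
`[-π/3, π/3]`, and satisfying the quadrature mirror filter identity. -/
structure IsLowPassFilter (m₀ : ℝ → ℝ) : Prop where
  continuous : Continuous m₀
  even : ∀ ξ, m₀ (-ξ) = m₀ ξ
  periodic : Function.Periodic m₀ (2 * π)
  map_zero : m₀ 0 = 1
  inf_ne_zero : ∃ c > 0, ∀ ξ ∈ Set.Icc (-(π / 3)) (π / 3), c ≤ |m₀ ξ|
  qmf : ∀ ξ, |m₀ ξ| ^ 2 + |m₀ (ξ + π)| ^ 2 = 1

/-- The infinite product `∏_{j ≥ 1} m₀(2^{-j} ξ)`. -/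
def filterProd (m₀ : ℝ → ℝ) (ξ : ℝ) : ℂ := ((∏' j : ℕ, m₀ (ξ / 2 ^ (j + 1)) : ℝ) : ℂ)

/-- The (Plancherel) Fourier transform of `φ ∈ L²(ℝ)` in the normalization
`φ̂(ξ) = ∫ φ(x) e^{-ixξ} dx`, obtained from Mathlib's `𝓕 φ(w) = ∫ φ(x) e^{-2πixw} dx`. -/
def fourierHat (φ : Lp ℂ 2 (volume : Measure ℝ)) (ξ : ℝ) : ℂ :=
  (𝓕 φ : Lp ℂ 2 (volume : Measure ℝ)) (ξ / (2 * π))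

/-- `φ ∈ L²(ℝ)` is the scaling function associated with the low-pass filter `m₀`:
`φ̂(ξ) = ∏_{j ≥ 1} m₀(2^{-j} ξ)`. -/
def IsScalingFunction (m₀ : ℝ → ℝ) (φ : Lp ℂ 2 (volume : Measure ℝ)) : Prop :=
  fourierHat φ =ᵐ[volume] filterProd m₀

/-- `σ_η = (σ + η(σ-1)) / (1 + η(σ-1))`. -/
def sigmaEta (σ η : ℝ) : ℝ := (σ + η * (σ - 1)) / (1 + η * (σ - 1))

/-- On `[0, ∞)` the function `lambertW` is the inverse of `y ↦ y * exp y`. -/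
theorem lambertW_spec {x : ℝ} (hx : 0 ≤ x) :
    0 ≤ lambertW x ∧ lambertW x * Real.exp (lambertW x) = x := by
  have hex : ∃ y ∈ Set.Ici (-1 : ℝ), (fun y : ℝ => y * Real.exp y) y = x := by
    have hc : ContinuousOn (fun y : ℝ => y * Real.exp y) (Set.Icc 0 x) := by fun_prop
    have h := intermediate_value_Icc hx hc
    have hmem : x ∈ Set.Icc ((0 : ℝ) * Real.exp 0) (x * Real.exp x) :=
      ⟨by simpa using hx, le_mul_of_one_le_right hx (Real.one_le_exp hx)⟩
    obtain ⟨y, hy, hyx⟩ := h hmem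
    exact ⟨y, by simp only [Set.mem_Ici]; linarith [hy.1], hyx⟩
  have h2 : lambertW x * Real.exp (lambertW x) = x := Function.invFunOn_eq hex
  refine ⟨?_, h2⟩
  by_contra hneg
  push Not at hneg
  have := mul_neg_of_neg_of_pos hneg (Real.exp_pos (lambertW x))
  linarith

/-- For the filters considered here, `m₀ = 1` on `[-π/5, π/5]`. -/
theorem IsLowPassFilter.eq_one {m₀ : ℝ → ℝ} (hm : IsLowPassFilter m₀)
    (hcoz : Function.support m₀ ∩ Set.Icc 0 π ⊆ Set.Ico 0 (4 * π / 5)) {ξ : ℝ}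
    (hξ : |ξ| ≤ π / 5) : m₀ ξ = 1 := by
  have hπ := Real.pi_pos
  have key : ∀ x, 0 ≤ x → x ≤ π / 5 → |m₀ x| = 1 := by
    intro x h0 h1
    have hz : m₀ (π - x) = 0 := by
      by_contra hne
      have := hcoz ⟨hne, by linarith, by linarith⟩
      linarith [this.2]
    have hz' : m₀ (x + π) = 0 := by
      rw [← hm.periodic.sub_eq, ← hm.even, ← hz]; congr 1; ring
    have hq := hm.qmf x
    rw [hz'] at hq
    have : |m₀ x| ^ 2 = 1 := by simpa using hq
    exact (pow_eq_one_iff_of_nonneg (abs_nonneg _) two_ne_zero).1 this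
  have key' : ∀ x, 0 ≤ x → x ≤ π / 5 → m₀ x = 1 := by
    intro x h0 h1
    rcases (abs_eq zero_le_one).1 (key x h0 h1) with h | h
    · exact h
    · exfalso
      have hmem : (0 : ℝ) ∈ Set.Icc (m₀ x) (m₀ 0) := by
        rw [h, hm.map_zero]; constructor <;> norm_num
      obtain ⟨y, hy, hy0⟩ := intermediate_value_Icc' h0 hm.continuous.continuousOn hmem
      have := key y hy.1 (hy.2.trans h1)
      rw [hy0] at this
      simp at this
  rcases le_total 0 ξ with h | h
  · exact key' ξ h (by rwa [abs_of_nonneg h] at hξ)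
  · rw [← hm.even]
    exact key' _ (by linarith) (by rwa [abs_of_nonpos h] at hξ)

/-- For the filters considered here the product in `filterProd` is, at each point, a product with
only finitely many factors different from `1`; in particular it converges. -/
theorem IsLowPassFilter.multipliable {m₀ : ℝ → ℝ} (hm : IsLowPassFilter m₀)
    (hcoz : Function.support m₀ ∩ Set.Icc 0 π ⊆ Set.Ico 0 (4 * π / 5)) (ξ : ℝ) :
    Multipliable fun j : ℕ => m₀ (ξ / 2 ^ (j + 1)) := by
  obtain ⟨N, hN⟩ := pow_unbounded_of_one_lt (|ξ| / (π / 5)) (one_lt_two : (1 : ℝ) < 2)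
  refine multipliable_of_ne_finset_one (s := Finset.range N) fun j hj => ?_
  apply hm.eq_one hcoz
  have hπ : 0 < π / 5 := by positivity
  have h1 : (2 : ℝ) ^ N ≤ 2 ^ (j + 1) :=
    pow_le_pow_right₀ one_le_two (by simp at hj; omega)
  rw [abs_div, abs_of_pos (by positivity : (0 : ℝ) < 2 ^ (j + 1)), div_le_iff₀ (by positivity)]
  rw [div_lt_iff₀ hπ] at hN
  nlinarith

end LowPass

end

open Real Set MeasureTheory
open scoped ENNReal FourierTransform ContDiff

noncomputable section

namespace LowPass

/-! ### The Lambert function and `omega` -/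

/-! Write Φ(ξ) = ∏ m₀(2^{-j}ξ) (`realProd`) and θ = σ/(σ-1). The filter is 1 on [-π/5, π/5] and 0 on
[4π/5, 6π/5], so Φ is locally a finite product. Doubling exchanges 2π/3 and -2π/3 modulo 2π;
following the zeros of m₀ along this orbit confines Φ, for |ξ| ≥ 8π/5, to blocks of bounded width
around ±2^n·2π/3 (`exists_block_of_realProd_ne_zero`).

Membership. In the n-th block the factor at ξ/2^n lies within O(2^{-n}) of the zero 2π/3, and the
upper bound on m₀ gives Φ ∈ Γ_σ (`exists_decay_realProd`). Since ω_σ(x) = x e^{W(x)/(σ-1)}, the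
moments of such a function grow like p^{τp^σ}, so its Fourier integral, which is φ, lies in ℰ_σ
(`memExtGevrey_of_decay`).

Non-membership. By the same implication with σ' in place of σ, only ℰ_{σ'} has to be excluded. On a
fixed interval beside 2^n·2π/3 there are n factors near the zero, each at least of size
exp(-const·n^θ), so |Φ| ≥ exp(-A n^{1+θ}) (`exists_lower_bound_realProd`). A bound on φ^{(p)} over
[-1, 1] is turned into a bound on this interval by pairing ξ^pΦ with a multiplier that is the symbol
of iterated averages and second differences of total reach 1 (`norm_integral_mul_multiplier_le`).
Its sinc powers suppress the other blocks and its difference powers peak in the middle of the chosen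
one, where Φ is real of constant sign, so nothing cancels (`block_le_of_fourierInt_le`).

With p ≈ n^a and N ≈ n^b the gain 2^{np} beats e^{A n^{1+θ}}, N^{2N} and p^{τp^{σ'}} when 1+θ < b <
a+1 and aσ' < a+1 (`eventually_exponents`). Such a, b exist once θ < 1/(σ'-1), and σ' < σ_η with η >
1 ensures this (`lt_one_div_of_lt_sigmaEta`). -/

theorem le_lambertW_of_mul_exp_le {x y : ℝ} (hx : 0 ≤ x) (hy : y * Real.exp y ≤ x) :
    y ≤ lambertW x := by
  obtain ⟨h0, h1⟩ := lambertW_spec hx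
  by_contra! h
  have : lambertW x * Real.exp (lambertW x) < y * Real.exp y :=
    mul_lt_mul h (Real.exp_le_exp.2 h.le) (Real.exp_pos _) (h0.trans h.le)
  linarith

theorem lambertW_le_of_le_mul_exp {x y : ℝ} (hx : 0 ≤ x) (hy : x ≤ y * Real.exp y) :
    lambertW x ≤ y := by
  obtain ⟨h0, h1⟩ := lambertW_spec hx
  by_contra! h
  have : y * Real.exp y < lambertW x * Real.exp (lambertW x) :=
    mul_lt_mul h (Real.exp_le_exp.2 h.le) (Real.exp_pos _) h0
  linarith

theorem lambertW_mono {x y : ℝ} (hx : 0 ≤ x) (hxy : x ≤ y) : lambertW x ≤ lambertW y :=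
  le_lambertW_of_mul_exp_le (hx.trans hxy) ((lambertW_spec hx).2.le.trans hxy)

theorem lambertW_mul_le {c x : ℝ} (hc : 1 ≤ c) (hx : 0 ≤ x) :
    lambertW (c * x) ≤ lambertW x + Real.log c := by
  obtain ⟨h0, h1⟩ := lambertW_spec hx
  have hl := Real.log_nonneg hc
  refine lambertW_le_of_le_mul_exp (by positivity) ?_
  rw [Real.exp_add, Real.exp_log (by positivity)]
  calc c * x = lambertW x * (Real.exp (lambertW x) * c) := by rw [← mul_assoc, h1, mul_comm]
    _ ≤ _ := by gcongr; linarith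

theorem exp_lambertW_le {x : ℝ} (hx : 0 ≤ x) : Real.exp (lambertW x) ≤ Real.exp 1 + x := by
  obtain ⟨h0, h1⟩ := lambertW_spec hx
  rcases le_total (lambertW x) 1 with h | h
  · have := Real.exp_le_exp.2 h
    linarith
  · have : Real.exp (lambertW x) ≤ lambertW x * Real.exp (lambertW x) :=
      le_mul_of_one_le_left (Real.exp_pos _).le h
    linarith [Real.exp_pos 1]

/-- Follows from x/W(x) = e^{W(x)}. This form has no quotient, and monotonicity, scaling and the
Legendre-type estimate are read off from it. -/
theorem omega_eq {σ x : ℝ} (hσ : 1 < σ) (hx : 0 ≤ x) :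
    omega σ x = x * Real.exp (lambertW x / (σ - 1)) := by
  unfold omega
  split_ifs with h
  · simp [h]
  have hx' : 0 < x := lt_of_le_of_ne hx (Ne.symm h)
  obtain ⟨h0, h1⟩ := lambertW_spec hx
  have hw : 0 < lambertW x := by
    rcases h0.eq_or_lt with h2 | h2
    · rw [← h2] at h1; simp at h1; exact absurd h1.symm h
    · exact h2
  have hs : 0 < σ - 1 := by linarith
  have e1 : σ / (σ - 1) = 1 + 1 / (σ - 1) := by field_simp; ring
  rw [e1, Real.rpow_add hx', Real.rpow_one, mul_div_assoc,
    ← Real.div_rpow hx hw.le]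
  congr 1
  have : x / lambertW x = Real.exp (lambertW x) := by
    rw [div_eq_iff hw.ne', mul_comm]; exact h1.symm
  rw [this, ← Real.exp_mul]
  congr 1
  ring

theorem omega_mono {σ x y : ℝ} (hσ : 1 < σ) (hx : 0 ≤ x) (hxy : x ≤ y) :
    omega σ x ≤ omega σ y := by
  rw [omega_eq hσ hx, omega_eq hσ (hx.trans hxy)]
  have := lambertW_mono hx hxy
  have hs : 0 < σ - 1 := by linarith
  have : 0 ≤ y := hx.trans hxy
  gcongr

/-- The logarithmic gain from the denominator W is thrown away; the final exponent comparisons are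
strict, so it is not needed. -/
theorem omega_le {σ x : ℝ} (hσ : 1 < σ) (hx : 0 ≤ x) :
    omega σ x ≤ (Real.exp 1 + x) ^ (σ / (σ - 1)) := by
  have hs : 0 < σ - 1 := by linarith
  have e1 : σ / (σ - 1) = 1 + 1 / (σ - 1) := by field_simp; ring
  have hp : 0 < Real.exp 1 + x := by positivity
  rw [omega_eq hσ hx, e1, Real.rpow_add hp, Real.rpow_one, div_eq_mul_one_div (lambertW x),
    Real.exp_mul]
  have := exp_lambertW_le hx
  gcongr
  linarith [Real.exp_pos 1]

theorem omega_mul_le {σ c x : ℝ} (hσ : 1 < σ) (hc : 1 ≤ c) (hx : 0 ≤ x) :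
    omega σ (c * x) ≤ c * c ^ (1 / (σ - 1)) * omega σ x := by
  have hs : 0 < σ - 1 := by linarith
  rw [omega_eq hσ hx, omega_eq hσ (by positivity)]
  have h1 : Real.exp (lambertW (c * x) / (σ - 1)) ≤
      c ^ (1 / (σ - 1)) * Real.exp (lambertW x / (σ - 1)) := by
    rw [Real.rpow_def_of_pos (by positivity), ← Real.exp_add]
    apply Real.exp_le_exp.2
    rw [mul_one_div, ← add_div]
    gcongr
    linarith [lambertW_mul_le hc hx]
  calc c * x * Real.exp (lambertW (c * x) / (σ - 1))
      ≤ c * x * (c ^ (1 / (σ - 1)) * Real.exp (lambertW x / (σ - 1))) := by gcongr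
    _ = _ := by ring

/-- A bound for the Legendre transform of ρω. Once e^{W(x)/(σ-1)} exceeds P ≥ q/ρ the left side is
nonpositive; before that W(x) ≤ (σ-1) log P, so x = W e^W is at most (σ-1) log P · P^{σ-1}. -/
theorem linear_sub_omega_le {σ ρ q x : ℝ} (hσ : 1 < σ) (hρ : 0 < ρ) (hq : 0 ≤ q) (hx : 0 ≤ x) :
    q * x - ρ * omega σ x ≤
      q * ((σ - 1) * Real.log (max (q / ρ) 1) * max (q / ρ) 1 ^ (σ - 1)) := by
  have hs : 0 < σ - 1 := by linarith
  set P := max (q / ρ) 1 with hP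
  have hP1 : 1 ≤ P := le_max_right _ _
  have hlP := Real.log_nonneg hP1
  have hqP : q ≤ ρ * P := by
    have := le_max_left (q / ρ) 1
    rwa [div_le_iff₀' hρ] at this
  obtain ⟨h0, h1⟩ := lambertW_spec hx
  rw [omega_eq hσ hx]
  rcases le_total (lambertW x) ((σ - 1) * Real.log P) with h | h
  · have : x ≤ (σ - 1) * Real.log P * P ^ (σ - 1) := by
      rw [← h1, Real.rpow_def_of_pos (by positivity), mul_comm (Real.log P) (σ - 1)]
      gcongr
    calc _ ≤ q * x := by
          have : 0 ≤ ρ * (x * Real.exp (lambertW x / (σ - 1))) := by positivity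
          linarith
      _ ≤ _ := by gcongr
  · have : P ≤ Real.exp (lambertW x / (σ - 1)) := by
      rw [← Real.log_le_iff_le_exp (by positivity), le_div_iff₀ hs]
      linarith
    have h2 : q * x ≤ ρ * (x * Real.exp (lambertW x / (σ - 1))) := by
      calc q * x ≤ (ρ * P) * x := by gcongr
        _ = ρ * (x * P) := by ring
        _ ≤ _ := by gcongr
    have : 0 ≤ q * ((σ - 1) * Real.log P * P ^ (σ - 1)) := by positivity
    linarith

/-! ### The weight `gfun` and polynomial moments against it. -/

theorem log_one_add_mul_le {c y : ℝ} (hc : 1 ≤ c) (hy : 0 ≤ y) :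
    Real.log (1 + c * y) ≤ c * Real.log (1 + y) := by
  rw [← Real.log_rpow (by positivity)]
  exact Real.log_le_log (by positivity) (one_add_mul_self_le_rpow_one_add (by linarith) hc)

theorem gfun_neg (σ x : ℝ) : gfun σ (-x) = gfun σ x := by simp [gfun]

theorem gfun_mono {σ x y : ℝ} (hσ : 1 < σ) (hxy : |x| ≤ |y|) : gfun σ x ≤ gfun σ y :=
  omega_mono hσ (Real.log_nonneg (by linarith [abs_nonneg x]))
    (Real.log_le_log (by positivity) (by linarith))

theorem gfun_mul_le {σ c x : ℝ} (hσ : 1 < σ) (hc : 1 ≤ c) :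
    gfun σ (c * x) ≤ c * c ^ (1 / (σ - 1)) * gfun σ x := by
  have h0 : 0 ≤ Real.log (1 + |x|) := Real.log_nonneg (by linarith [abs_nonneg x])
  refine le_trans ?_ (omega_mul_le hσ hc h0)
  refine omega_mono hσ (Real.log_nonneg (by linarith [abs_nonneg (c * x)])) ?_
  rw [abs_mul, abs_of_nonneg (by linarith : (0 : ℝ) ≤ c)]
  exact log_one_add_mul_le hc (abs_nonneg x)

theorem pow_mul_exp_gfun_le {σ ρ : ℝ} (hσ : 1 < σ) (hρ : 0 < ρ) (q : ℕ) (x : ℝ) :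
    (1 + |x|) ^ q * Real.exp (-ρ * gfun σ x) ≤
      Real.exp (q * ((σ - 1) * Real.log (max (q / ρ) 1) * max (q / ρ) 1 ^ (σ - 1))) := by
  have h := linear_sub_omega_le (q := q) hσ hρ (by positivity)
    (Real.log_nonneg (by linarith [abs_nonneg x] : 1 ≤ 1 + |x|))
  rw [← Real.exp_log (by positivity : 0 < (1 + |x|) ^ q), ← Real.exp_add, Real.log_pow]
  apply Real.exp_le_exp.2
  unfold gfun
  linarith

/-- The weighted bounds coming from decay of order `σ` grow at most like a Gevrey sequence. -/
theorem exists_gevreySeq_bound {σ ρ D : ℝ} (hσ : 1 < σ) (hρ : 0 < ρ) :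
    ∃ τ > 0, ∃ C > 0, ∀ p : ℕ,
      D * Real.exp (((p + 2 : ℕ) : ℝ) * ((σ - 1) * Real.log (max (((p + 2 : ℕ) : ℝ) / ρ) 1) *
        max (((p + 2 : ℕ) : ℝ) / ρ) 1 ^ (σ - 1))) ≤ C ^ ((p : ℝ) ^ σ + 1) * gevreySeq τ σ p := by
  have hs : 0 < σ - 1 := by linarith
  -- For p ≥ 1 one has p + 2 ≤ 3p, hence max((p+2)/ρ, 1) ≤ A p.
  set A : ℝ := 3 * max (1 / ρ) 1 with hA
  have hm : 1 ≤ max (1 / ρ) 1 := le_max_right _ _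
  have hA3 : 3 ≤ A := by linarith
  have hA0 : 0 < A := by linarith
  set τ : ℝ := 3 * (σ - 1) * A ^ (σ - 1) with hτ
  have hτ0 : 0 < τ := by positivity
  set E0 : ℝ := Real.exp (((0 + 2 : ℕ) : ℝ) * ((σ - 1) * Real.log (max (((0 + 2 : ℕ) : ℝ) / ρ) 1) *
        max (((0 + 2 : ℕ) : ℝ) / ρ) 1 ^ (σ - 1))) with hE0
  -- The entry |D| * E0 serves p = 0 only, where 0^σ = 0 leaves the right side equal to C.
  set C : ℝ := max (max (|D| * E0) |D|) (Real.exp (τ * Real.log A)) with hC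
  have hCD : |D| ≤ C := (le_max_right _ _).trans (le_max_left _ _)
  have hCE : |D| * E0 ≤ C := (le_max_left _ _).trans (le_max_left _ _)
  have hCA : Real.exp (τ * Real.log A) ≤ C := le_max_right _ _
  have hC0 : 0 < C := lt_of_lt_of_le (Real.exp_pos _) hCA
  refine ⟨τ, hτ0, C, hC0, fun p => ?_⟩
  rcases Nat.eq_zero_or_pos p with rfl | hp
  · have hz : (0 : ℝ) ^ σ = 0 := Real.zero_rpow (by linarith)
    simp only [gevreySeq, if_true, Nat.cast_zero, hz, zero_add, Real.rpow_one, mul_one]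
    have := le_abs_self D
    have hE : 0 ≤ E0 := (Real.exp_pos _).le
    refine le_trans ?_ hCE
    rw [hE0]
    simp only [zero_add] at *
    gcongr
  have hp1 : (1 : ℝ) ≤ p := by exact_mod_cast hp
  have hlp := Real.log_nonneg hp1
  simp only [gevreySeq, hp.ne', if_false]
  set q : ℝ := ((p + 2 : ℕ) : ℝ) with hq
  have hq3 : q ≤ 3 * p := by rw [hq]; push_cast; linarith
  have hq0 : 0 ≤ q := by positivity
  set P := max (q / ρ) 1 with hP
  have hP1 : 1 ≤ P := le_max_right _ _
  have hPA : P ≤ A * p := by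
    apply max_le
    · calc q / ρ = q * (1 / ρ) := by ring
        _ ≤ (3 * p) * max (1 / ρ) 1 := by gcongr; exact le_max_left _ _
        _ = A * p := by rw [hA]; ring
    · nlinarith
  have hlP := Real.log_nonneg hP1
  have hlA : 0 ≤ Real.log A := Real.log_nonneg (by linarith)
  have hlog : Real.log P ≤ Real.log A + Real.log p := by
    rw [← Real.log_mul hA0.ne' (by positivity)]
    exact Real.log_le_log (by positivity) hPA
  have hpow : P ^ (σ - 1) ≤ A ^ (σ - 1) * (p : ℝ) ^ (σ - 1) := by
    rw [← Real.mul_rpow hA0.le (by positivity)]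
    exact Real.rpow_le_rpow (by positivity) hPA hs.le
  have hpp : (p : ℝ) * (p : ℝ) ^ (σ - 1) = (p : ℝ) ^ σ := by
    rw [Real.rpow_sub_one (by positivity)]; field_simp
  have hexp : q * ((σ - 1) * Real.log P * P ^ (σ - 1)) ≤
      τ * Real.log A * (p : ℝ) ^ σ + τ * (p : ℝ) ^ σ * Real.log p := by
    calc q * ((σ - 1) * Real.log P * P ^ (σ - 1))
        ≤ (3 * p) * ((σ - 1) * (Real.log A + Real.log p) * (A ^ (σ - 1) * (p : ℝ) ^ (σ - 1))) := by
          gcongr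
      _ = (3 * (σ - 1) * A ^ (σ - 1)) * (Real.log A + Real.log p) * (p * (p : ℝ) ^ (σ - 1)) := by
          ring
      _ = _ := by rw [hpp, ← hτ]; ring
  calc D * Real.exp (q * ((σ - 1) * Real.log P * P ^ (σ - 1)))
      ≤ C * Real.exp (τ * Real.log A * (p : ℝ) ^ σ + τ * (p : ℝ) ^ σ * Real.log p) := by
        gcongr
        exact (le_abs_self D).trans hCD
    _ = C * (Real.exp (τ * Real.log A) ^ ((p : ℝ) ^ σ) * (p : ℝ) ^ (τ * (p : ℝ) ^ σ)) := by
        rw [Real.exp_add, Real.exp_mul (τ * Real.log A), Real.rpow_def_of_pos (by positivity : (0 : ℝ) < p)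
          (τ * (p : ℝ) ^ σ)]
        ring_nf
    _ ≤ C * (C ^ ((p : ℝ) ^ σ) * (p : ℝ) ^ (τ * (p : ℝ) ^ σ)) := by gcongr
    _ = _ := by rw [Real.rpow_add hC0, Real.rpow_one]; ring

/-! ### The scaling function as an inverse Fourier integral -/

/-- If the Plancherel transform of `φ` agrees almost everywhere with an integrable function `G`,
then `φ` is the inverse Fourier integral of `G`. -/
theorem ae_eq_fourierInv_of_fourier_ae_eq (φ : Lp ℂ 2 (volume : Measure ℝ)) {G : ℝ → ℂ}
    (hG : Integrable G) (hφ : (𝓕 φ : Lp ℂ 2 (volume : Measure ℝ)) =ᵐ[volume] G) :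
    φ =ᵐ[volume] 𝓕⁻ G := by
  have hcont : Continuous (𝓕⁻ G) := by
    have : 𝓕⁻ G = fun x => 𝓕 G (-x) := by ext x; exact Real.fourierInv_eq_fourier_neg G x
    rw [this]
    exact (VectorFourier.fourierIntegral_continuous Real.continuous_fourierChar
      continuous_inner hG).comp continuous_neg
  refine ae_eq_of_integral_contDiff_smul_eq ((Lp.memLp φ).locallyIntegrable one_le_two)
    hcont.locallyIntegrable fun g g_smooth g_cpt => ?_
  have hg₁ : HasCompactSupport (Complex.ofRealCLM ∘ g) := g_cpt.comp_left rfl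
  have hg₂ : ContDiff ℝ ∞ (Complex.ofRealCLM ∘ g) := by fun_prop
  set ψ : SchwartzMap ℝ ℂ := hg₁.toSchwartzMap hg₂ with hψ
  have hψg : ∀ x, ψ x = (g x : ℂ) := fun x => rfl
  -- Fourier inversion, read in tempered distributions, moves the inverse transform onto the test
  -- function; Fubini then moves it back onto the integrable G.
  have h1 : ∫ x, ψ x • (φ : ℝ → ℂ) x = ∫ x, (𝓕⁻ ψ) x • (𝓕 φ : Lp ℂ 2 (volume : Measure ℝ)) x := by
    have := congrArg (fun T : TemperedDistribution ℝ ℂ => T ψ)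
      (Lp.fourierInv_toTemperedDistribution_eq (𝓕 φ : Lp ℂ 2 (volume : Measure ℝ)))
    simp only [FourierTransform.fourierInv_fourier_eq] at this
    rw [Lp.toTemperedDistribution_apply] at this
    rw [← this]
    simp [TemperedDistribution.fourierInv_apply]
  have h2 : ∫ x, (𝓕⁻ ψ) x • (𝓕 φ : Lp ℂ 2 (volume : Measure ℝ)) x = ∫ x, (𝓕⁻ ψ) x • G x := by
    apply integral_congr_ae
    filter_upwards [hφ] with x hx
    rw [hx]
  have h3 : ∫ x, (𝓕⁻ ψ) x • G x = ∫ x, ψ x • (𝓕⁻ G) x := by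
    have hflip : ∫ x, 𝓕 (fun y => ψ (-y)) x • G x = ∫ x, ψ (-x) • 𝓕 G x := by
      simpa using! VectorFourier.integral_fourierIntegral_smul_eq_flip (L := innerₗ ℝ)
        Real.continuous_fourierChar continuous_inner ψ.integrable.comp_neg hG
    rw [SchwartzMap.fourierInv_coe, Real.fourierInv_eq_fourier_comp_neg, hflip,
      ← integral_neg_eq_self]
    simp [Real.fourierInv_eq_fourier_neg]
  have h4 := h1.trans (h2.trans h3)
  simpa only [hψg, Complex.coe_smul] using! h4

theorem integrable_pow_mul_comp {g : ℝ → ℝ} (hg : ∀ p : ℕ, Integrable fun ξ => ξ ^ p * g ξ)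
    (p : ℕ) : Integrable fun w : ℝ => w ^ p • (g (2 * π * w) : ℂ) := by
  have h := ((hg p).comp_mul_left' (by positivity : 2 * π ≠ 0)).const_mul (((2 * π) ^ p)⁻¹)
  have h' : Integrable fun w : ℝ =>
      ((((2 * π) ^ p)⁻¹ * ((2 * π * w) ^ p * g (2 * π * w)) : ℝ) : ℂ) := h.ofReal
  refine h'.congr (ae_of_all _ fun w => ?_)
  have : (2 * (π : ℂ)) ≠ 0 := by exact_mod_cast (by positivity : 2 * π ≠ 0)
  simp only [Complex.real_smul]
  push_cast
  field_simp
  ring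

theorem contDiff_fourier_comp {g : ℝ → ℝ} (hg : ∀ p : ℕ, Integrable fun ξ => ξ ^ p * g ξ) :
    ContDiff ℝ ∞ (𝓕 fun w : ℝ => (g (2 * π * w) : ℂ)) := by
  apply Real.contDiff_fourier
  intro n _
  refine (integrable_pow_mul_comp hg n).norm.congr (ae_of_all _ fun w => ?_)
  simp

/-- The dilation by 2π converts the e^{-2πixw} normalization to e^{-ixξ}, so that derivatives
produce plain powers of ξ. -/
theorem iteratedDeriv_fourier_comp {g : ℝ → ℝ} (hg : ∀ p : ℕ, Integrable fun ξ => ξ ^ p * g ξ)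
    (p : ℕ) (x : ℝ) :
    iteratedDeriv p (𝓕 fun w : ℝ => (g (2 * π * w) : ℂ)) x =
      (2 * π)⁻¹ * ((-Complex.I) ^ p *
        ∫ ξ, ((ξ ^ p * g ξ : ℝ) : ℂ) * Complex.exp (((-x * ξ : ℝ) : ℂ) * Complex.I)) := by
  rw [Real.iteratedDeriv_fourier (N := ⊤) (fun n _ => integrable_pow_mul_comp hg n) le_top,
    Real.fourier_real_eq_integral_exp_smul]
  have h := Measure.integral_comp_mul_left (fun ξ : ℝ => (-Complex.I) ^ p *
    (((ξ ^ p * g ξ : ℝ) : ℂ) * Complex.exp (((-x * ξ : ℝ) : ℂ) * Complex.I))) (2 * π)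
  rw [integral_const_mul, integral_const_mul, abs_of_pos (by positivity), Complex.real_smul] at h
  push_cast at h ⊢
  rw [← h, ← integral_const_mul]
  congr 1
  ext w
  simp only [smul_eq_mul]
  rw [show -(x : ℂ) * (2 * π * w) * Complex.I = -2 * π * w * x * Complex.I by ring,
    show (-2 * π * Complex.I * w : ℂ) = -Complex.I * (2 * π * w) by ring, mul_pow]
  ring

theorem norm_iteratedDeriv_fourier_comp_le {g : ℝ → ℝ}
    (hg : ∀ p : ℕ, Integrable fun ξ => ξ ^ p * g ξ) (p : ℕ) (x : ℝ) :
    ‖iteratedDeriv p (𝓕 fun w : ℝ => (g (2 * π * w) : ℂ)) x‖ ≤ ∫ ξ, |ξ ^ p * g ξ| := by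
  rw [iteratedDeriv_fourier_comp hg]
  have h1 : ‖∫ ξ, ((ξ ^ p * g ξ : ℝ) : ℂ) * Complex.exp (((-x * ξ : ℝ) : ℂ) * Complex.I)‖ ≤
      ∫ ξ, |ξ ^ p * g ξ| := by
    refine (norm_integral_le_integral_norm _).trans (le_of_eq ?_)
    congr 1
    ext ξ
    rw [norm_mul, Complex.norm_exp_ofReal_mul_I, mul_one, Complex.norm_real, Real.norm_eq_abs]
  have h2 : ‖(((2 * π)⁻¹ : ℝ) : ℂ)‖ ≤ 1 := by
    rw [Complex.ofReal_inv, norm_inv, Complex.norm_real, Real.norm_of_nonneg (by positivity)]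
    apply inv_le_one_of_one_le₀
    linarith [Real.pi_gt_three]
  have h3 : ‖(-Complex.I) ^ p‖ = 1 := by simp
  rw [norm_mul, norm_mul, h3, one_mul]
  exact (mul_le_of_le_one_left (norm_nonneg _) h2).trans h1

theorem integrable_one_add_abs_sq : Integrable fun ξ : ℝ => ((1 + |ξ|) ^ 2)⁻¹ := by
  have h := integrable_one_add_norm (E := ℝ) (μ := volume) (r := 2) (by simp)
  refine h.congr (ae_of_all _ fun ξ => ?_)
  simp only [Real.norm_eq_abs]
  rw [Real.rpow_neg (by positivity)]
  norm_cast

/-- Two powers beyond p are spent on the integrable factor (1+|ξ|)^{-2}; this is the source of p +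
2. -/
theorem abs_pow_mul_le_of_decay {σ ρ C : ℝ} (hσ : 1 < σ) (hρ : 0 < ρ) (hC : 0 < C) {g : ℝ → ℝ}
    (hg : ∀ ξ, |g ξ| ≤ C * Real.exp (-ρ * gfun σ ξ)) (p : ℕ) (ξ : ℝ) :
    |ξ ^ p * g ξ| ≤ C * Real.exp (((p + 2 : ℕ) : ℝ) * ((σ - 1) *
      Real.log (max (((p + 2 : ℕ) : ℝ) / ρ) 1) * max (((p + 2 : ℕ) : ℝ) / ρ) 1 ^ (σ - 1))) *
        ((1 + |ξ|) ^ 2)⁻¹ := by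
  have hb := pow_mul_exp_gfun_le hσ hρ (p + 2) ξ
  have h0 : 0 < 1 + |ξ| := by positivity
  rw [← div_eq_mul_inv, le_div_iff₀ (by positivity), abs_mul, abs_pow]
  calc |ξ| ^ p * |g ξ| * (1 + |ξ|) ^ 2
      ≤ (1 + |ξ|) ^ p * (C * Real.exp (-ρ * gfun σ ξ)) * (1 + |ξ|) ^ 2 := by
        gcongr
        · linarith
        · exact hg ξ
    _ = C * ((1 + |ξ|) ^ (p + 2) * Real.exp (-ρ * gfun σ ξ)) := by ring
    _ ≤ _ := by gcongr

theorem integrable_pow_mul_of_decay {σ ρ C : ℝ} (hσ : 1 < σ) (hρ : 0 < ρ) (hC : 0 < C)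
    {g : ℝ → ℝ} (hgc : Continuous g) (hg : ∀ ξ, |g ξ| ≤ C * Real.exp (-ρ * gfun σ ξ)) (p : ℕ) :
    Integrable fun ξ => ξ ^ p * g ξ :=
  (integrable_one_add_abs_sq.const_mul _).mono' (by fun_prop)
    (ae_of_all _ fun ξ => abs_pow_mul_le_of_decay hσ hρ hC hg p ξ)

/-- Fourier integrals of functions in `Γ_σ` are in `ℰ_σ`. -/
theorem memExtGevrey_of_decay {σ ρ C : ℝ} (hσ : 1 < σ) (hρ : 0 < ρ) (hC : 0 < C)
    {g : ℝ → ℝ} (hgc : Continuous g) (hg : ∀ ξ, |g ξ| ≤ C * Real.exp (-ρ * gfun σ ξ)) :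
    MemExtGevrey σ (𝓕 fun w : ℝ => (g (2 * π * w) : ℂ)) := by
  have hi := integrable_pow_mul_of_decay hσ hρ hC hgc hg
  obtain ⟨τ, hτ, C', hC', h⟩ := exists_gevreySeq_bound
    (D := C * ∫ ξ : ℝ, ((1 + |ξ|) ^ 2)⁻¹) hσ hρ
  refine ⟨τ, hτ, contDiff_fourier_comp hi, fun K _ => ⟨C', hC', fun p x _ => ?_⟩⟩
  refine (norm_iteratedDeriv_fourier_comp_le hi p x).trans (le_trans ?_ (h p))
  refine (integral_mono (hi p).abs (integrable_one_add_abs_sq.const_mul _)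
    (abs_pow_mul_le_of_decay hσ hρ hC hg p)).trans (le_of_eq ?_)
  rw [integral_const_mul]
  ring

/-! ### The infinite product -/

/-- The infinite product `∏_{j ≥ 1} m₀(2^{-j} ξ)` as a real number. -/
def realProd (m₀ : ℝ → ℝ) (ξ : ℝ) : ℝ := ∏' j : ℕ, m₀ (ξ / 2 ^ (j + 1))

theorem filterProd_eq_ofReal (m₀ : ℝ → ℝ) (ξ : ℝ) : filterProd m₀ ξ = (realProd m₀ ξ : ℂ) := rfl

variable {m₀ : ℝ → ℝ}

theorem IsLowPassFilter.abs_le_one (hm : IsLowPassFilter m₀) (ξ : ℝ) : |m₀ ξ| ≤ 1 := by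
  have h := hm.qmf ξ
  have : |m₀ ξ| ^ 2 ≤ 1 := by nlinarith [sq_nonneg |m₀ (ξ + π)|]
  exact (sq_le_one_iff₀ (abs_nonneg _)).1 this

theorem realProd_neg (hm : IsLowPassFilter m₀) (ξ : ℝ) : realProd m₀ (-ξ) = realProd m₀ ξ := by
  simp [realProd, neg_div, hm.even]

theorem realProd_eq_prod_range (hm : IsLowPassFilter m₀)
    (hcoz : Function.support m₀ ∩ Set.Icc 0 π ⊆ Set.Ico 0 (4 * π / 5)) {N : ℕ} {ξ : ℝ}
    (hξ : |ξ| ≤ 2 ^ (N + 1) * (π / 5)) :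
    realProd m₀ ξ = ∏ j ∈ Finset.range N, m₀ (ξ / 2 ^ (j + 1)) := by
  refine tprod_eq_prod fun j hj => hm.eq_one hcoz ?_
  have h1 : (2 : ℝ) ^ (N + 1) ≤ 2 ^ (j + 1) :=
    pow_le_pow_right₀ one_le_two (by simpa using hj)
  rw [abs_div, abs_of_pos (by positivity : (0 : ℝ) < 2 ^ (j + 1)), div_le_iff₀ (by positivity)]
  have hπ : 0 < π / 5 := by positivity
  nlinarith

theorem exists_pow_bound (R : ℝ) : ∃ N : ℕ, R ≤ 2 ^ (N + 1) * (π / 5) := by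
  obtain ⟨N, hN⟩ := pow_unbounded_of_one_lt (R / (π / 5)) (one_lt_two : (1 : ℝ) < 2)
  have hπ : 0 < π / 5 := by positivity
  refine ⟨N, ?_⟩
  rw [div_lt_iff₀ hπ] at hN
  rw [pow_succ]
  nlinarith [pow_pos (two_pos : (0 : ℝ) < 2) N]

theorem continuous_realProd (hm : IsLowPassFilter m₀)
    (hcoz : Function.support m₀ ∩ Set.Icc 0 π ⊆ Set.Ico 0 (4 * π / 5)) :
    Continuous (realProd m₀) := by
  rw [continuous_iff_continuousAt]
  intro ξ
  obtain ⟨N, hN⟩ := exists_pow_bound (|ξ| + 1)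
  have hc : Continuous fun x => ∏ j ∈ Finset.range N, m₀ (x / 2 ^ (j + 1)) :=
    continuous_finsetProd _ fun j _ => hm.continuous.comp (by fun_prop)
  refine hc.continuousAt.congr ?_
  filter_upwards [Metric.ball_mem_nhds ξ one_pos] with x hx
  refine (realProd_eq_prod_range hm hcoz (le_trans ?_ hN)).symm
  rw [Metric.mem_ball, Real.dist_eq] at hx
  linarith [abs_sub_abs_le_abs_sub x ξ]

/-- The quadrature identity bounds every other factor by 1, so any single factor controls the
product. -/
theorem abs_realProd_le_factor (hm : IsLowPassFilter m₀)
    (hcoz : Function.support m₀ ∩ Set.Icc 0 π ⊆ Set.Ico 0 (4 * π / 5)) (ξ : ℝ) (j : ℕ) :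
    |realProd m₀ ξ| ≤ |m₀ (ξ / 2 ^ (j + 1))| := by
  obtain ⟨N, hN⟩ := exists_pow_bound |ξ|
  have hN' : |ξ| ≤ 2 ^ (max N (j + 1) + 1) * (π / 5) := by
    refine hN.trans ?_
    gcongr
    · norm_num
    · exact le_max_left _ _
  have hj : j ∈ Finset.range (max N (j + 1)) := by simp
  rw [realProd_eq_prod_range hm hcoz hN', ← Finset.mul_prod_erase _ _ hj, abs_mul, Finset.abs_prod]
  exact mul_le_of_le_one_right (abs_nonneg _)
    (Finset.prod_le_one (fun _ _ => abs_nonneg _) fun _ _ => hm.abs_le_one _)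

theorem abs_realProd_le_one (hm : IsLowPassFilter m₀)
    (hcoz : Function.support m₀ ∩ Set.Icc 0 π ⊆ Set.Ico 0 (4 * π / 5)) (ξ : ℝ) :
    |realProd m₀ ξ| ≤ 1 :=
  (abs_realProd_le_factor hm hcoz ξ 0).trans (hm.abs_le_one _)

/-! ### Zeros of the filter and the orbit of 2π/3 under doubling. -/

theorem IsLowPassFilter.apply_two_pi_sub (hm : IsLowPassFilter m₀) (x : ℝ) :
    m₀ (2 * π - x) = m₀ x := by
  rw [hm.periodic.sub_eq', hm.even]

theorem IsLowPassFilter.eq_zero (hm : IsLowPassFilter m₀)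
    (hcoz : Function.support m₀ ∩ Set.Icc 0 π ⊆ Set.Ico 0 (4 * π / 5)) {x : ℝ}
    (h1 : 4 * π / 5 ≤ x) (h2 : x ≤ 6 * π / 5) : m₀ x = 0 := by
  have hπ := Real.pi_pos
  have key : ∀ y, 4 * π / 5 ≤ y → y ≤ π → m₀ y = 0 := by
    intro y h3 h4
    by_contra hne
    have := hcoz ⟨hne, by linarith, h4⟩
    linarith [this.2]
  rcases le_total x π with h | h
  · exact key x h1 h
  · rw [← hm.apply_two_pi_sub]
    exact key _ (by linarith) (by linarith)

/-- Modulo 2π, the point 2^a·2π/3 is 2π/3 or 4π/3 according to 2^a mod 3. In the second case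
evenness returns it to 2π/3 and reverses the displacement. -/
theorem IsLowPassFilter.apply_of_mod_one (hm : IsLowPassFilter m₀) {a m : ℕ}
    (h : 2 ^ a = 3 * m + 1) (v : ℝ) : m₀ (2 ^ a * (2 * π / 3) + v) = m₀ (2 * π / 3 + v) := by
  have h' : (2 : ℝ) ^ a = 3 * m + 1 := by exact_mod_cast h
  rw [h', show (3 * (m : ℝ) + 1) * (2 * π / 3) + v = (2 * π / 3 + v) + m * (2 * π) by ring]
  exact hm.periodic.nat_mul m _

theorem IsLowPassFilter.apply_of_mod_two (hm : IsLowPassFilter m₀) {a m : ℕ}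
    (h : 2 ^ a = 3 * m + 2) (v : ℝ) : m₀ (2 ^ a * (2 * π / 3) + v) = m₀ (2 * π / 3 - v) := by
  have h' : (2 : ℝ) ^ a = 3 * m + 2 := by exact_mod_cast h
  rw [h', show (3 * (m : ℝ) + 2) * (2 * π / 3) + v = (4 * π / 3 + v) + m * (2 * π) by ring,
    hm.periodic.nat_mul m, ← hm.apply_two_pi_sub]
  congr 1
  ring

theorem two_pow_mod_three (a : ℕ) :
    (∃ m, 2 ^ a = 3 * m + 1) ∨ ∃ m, 2 ^ a = 3 * m + 2 := by
  induction a with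
  | zero => exact Or.inl ⟨0, rfl⟩
  | succ a ih =>
    rcases ih with ⟨m, hm⟩ | ⟨m, hm⟩
    · exact Or.inr ⟨2 * m, by rw [pow_succ, hm]; ring⟩
    · exact Or.inl ⟨2 * m + 1, by rw [pow_succ, hm]; ring⟩

/-- The two arguments reduce to 2π/3 + v and 2π/3 - 2v with v = ±w. If v ≥ 2π/15 the first falls in
the zero interval [4π/5, 6π/5]; if v ≤ -2π/15 the second does. -/
theorem IsLowPassFilter.abs_lt_of_ne_zero (hm : IsLowPassFilter m₀)
    (hcoz : Function.support m₀ ∩ Set.Icc 0 π ⊆ Set.Ico 0 (4 * π / 5)) {a : ℕ} {w : ℝ}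
    (hw : |w| < 4 * π / 15) (h1 : m₀ (2 ^ a * (2 * π / 3) + w) ≠ 0)
    (h2 : m₀ (2 ^ (a + 1) * (2 * π / 3) + 2 * w) ≠ 0) : |w| < 2 * π / 15 := by
  have key : ∀ v : ℝ, |v| < 4 * π / 15 → m₀ (2 * π / 3 + v) ≠ 0 → m₀ (2 * π / 3 - 2 * v) ≠ 0 →
      |v| < 2 * π / 15 := by
    intro v hv hv1 hv2
    rw [abs_lt] at hv ⊢
    constructor
    · by_contra! h
      exact hv2 (hm.eq_zero hcoz (by linarith) (by linarith))
    · by_contra! h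
      exact hv1 (hm.eq_zero hcoz (by linarith) (by linarith))
  rcases two_pow_mod_three a with ⟨m, h⟩ | ⟨m, h⟩
  · rw [hm.apply_of_mod_one h] at h1
    rw [hm.apply_of_mod_two (m := 2 * m) (by rw [pow_succ, h]; ring)] at h2
    exact key w hw h1 h2
  · rw [hm.apply_of_mod_two h] at h1
    rw [hm.apply_of_mod_one (m := 2 * m + 1) (by rw [pow_succ, h]; ring)] at h2
    have := key (-w) (by rwa [abs_neg]) (by rwa [← sub_eq_add_neg])
      (by rwa [mul_neg, sub_neg_eq_add])
    rwa [abs_neg] at this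

/-- Away from a neighbourhood of the origin the infinite product lives on bounded neighbourhoods of
the points `± 2^n * 2π/3`. -/
theorem exists_block_of_realProd_ne_zero (hm : IsLowPassFilter m₀)
    (hcoz : Function.support m₀ ∩ Set.Icc 0 π ⊆ Set.Ico 0 (4 * π / 5)) {ξ : ℝ}
    (hξ : 8 * π / 5 ≤ ξ) (hne : realProd m₀ ξ ≠ 0) :
    ∃ n : ℕ, 2 ≤ n ∧ |ξ - 2 ^ n * (2 * π / 3)| < 8 * π / 15 := by
  have hπ := Real.pi_pos
  have hfac : ∀ j : ℕ, m₀ (ξ / 2 ^ (j + 1)) ≠ 0 := by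
    intro j h
    have := abs_realProd_le_factor hm hcoz ξ j
    rw [h, abs_zero] at this
    exact hne (abs_eq_zero.1 (le_antisymm this (abs_nonneg _)))
  have hx4 : 4 ≤ ξ / (2 * π / 5) := by
    rw [le_div_iff₀ (by positivity)]; linarith
  -- Chosen so that ξ/2^n lies in [2π/5, 4π/5).
  obtain ⟨n, hn1, hn2⟩ := exists_nat_pow_near (by linarith : 1 ≤ ξ / (2 * π / 5))
    (one_lt_two : (1 : ℝ) < 2)
  have hn : 2 ≤ n := by
    by_contra! h
    have : (2 : ℝ) ^ (n + 1) ≤ 2 ^ 2 := pow_le_pow_right₀ one_le_two (by omega)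
    linarith
  rw [le_div_iff₀ (by positivity)] at hn1
  rw [div_lt_iff₀ (by positivity)] at hn2
  obtain ⟨k, rfl⟩ := Nat.exists_eq_add_of_le' hn
  refine ⟨k + 2, hn, ?_⟩
  set u := ξ - 2 ^ (k + 2) * (2 * π / 3) with hu
  have hP : (0 : ℝ) < 2 ^ (k + 1) := by positivity
  have hP2 : (2 : ℝ) ^ (k + 2) = 2 * 2 ^ (k + 1) := by ring
  have hP3 : (2 : ℝ) ^ (k + 2 + 1) = 4 * 2 ^ (k + 1) := by ring
  -- Otherwise ξ/2^(n-1) would lie in the zero interval. Hence 3π/5 < ξ/2^n < 4π/5, within 2π/15 of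
  -- 2π/3.
  have hlow : 6 * π / 5 < ξ / 2 ^ (k + 1) := by
    by_contra! h
    refine hfac k (hm.eq_zero hcoz ?_ h)
    rw [le_div_iff₀ hP]
    rw [hP2] at hn1
    nlinarith
  rw [lt_div_iff₀ hP] at hlow
  have hbase : |u| < 2 ^ (k + 2) * (2 * π / 15) := by
    rw [abs_lt, hu, hP2]
    rw [hP3] at hn2
    constructor <;> nlinarith
  -- Descend in j: nonvanishing at the two consecutive scales j + 2 and j + 1 halves the bound on
  -- |u| each time, until j = 0.
  have hind : ∀ i j : ℕ, j + i = k → |u| < 2 ^ (j + 2) * (2 * π / 15) := by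
    intro i
    induction i with
    | zero => intro j hj; rw [show j = k by omega]; exact hbase
    | succ i ih =>
      intro j hj
      have h1 := ih (j + 1) (by omega)
      have hQ : (0 : ℝ) < 2 ^ (j + 2) := by positivity
      have hQ1 : (2 : ℝ) ^ (j + 1 + 2) = 2 * 2 ^ (j + 2) := by ring
      have hkij : (2 : ℝ) ^ (k + 2) = 2 ^ (i + 1) * 2 ^ (j + 2) := by
        rw [← pow_add]; congr 1; omega
      have hξu : ξ = 2 ^ (k + 2) * (2 * π / 3) + u := by rw [hu]; ring
      have hw : |u / 2 ^ (j + 2)| < 2 * π / 15 := by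
        refine hm.abs_lt_of_ne_zero hcoz (a := i + 1) ?_ ?_ ?_
        · rw [abs_div, abs_of_pos hQ, div_lt_iff₀ hQ]
          rw [hQ1] at h1
          linarith
        · have := hfac (j + 1)
          convert this using 2
          rw [hξu, hkij]
          field_simp
        · have := hfac j
          convert this using 2
          rw [hξu, hkij]
          field_simp
          ring
      rw [abs_div, abs_of_pos hQ, div_lt_iff₀ hQ] at hw
      linarith
  have := hind k 0 (by omega)
  linarith

theorem eight_pi_div_fifteen_lt : 8 * π / 15 < 2 := by linarith [Real.pi_lt_d2]

/-- The infinite product has the decay of its filter at `2π/3`. -/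
theorem exists_decay_realProd (hm : IsLowPassFilter m₀)
    (hcoz : Function.support m₀ ∩ Set.Icc 0 π ⊆ Set.Ico 0 (4 * π / 5)) {σ ε C₀ ρ₀ : ℝ}
    (hσ : 1 < σ) (hε : 0 < ε) (hC₀ : 0 < C₀) (hρ₀ : 0 < ρ₀)
    (hup : ∀ v, |v| ≤ ε → |m₀ (2 * π / 3 + v)| ≤ C₀ * ffun ρ₀ σ v) :
    ∃ ρ > 0, ∃ C > 0, ∀ ξ, |realProd m₀ ξ| ≤ C * Real.exp (-ρ * gfun σ ξ) := by
  set c : ℝ := 8 * 8 ^ (1 / (σ - 1)) with hc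
  have hc0 : 0 < c := by positivity
  obtain ⟨n₀, hn₀⟩ := pow_unbounded_of_one_lt (2 / ε) (one_lt_two : (1 : ℝ) < 2)
  rw [div_lt_iff₀ hε] at hn₀
  -- Beyond R the block index satisfies 2^n ≥ 2^n₀ > 2/ε, so |u|/2^n ≤ ε and the hypothesis at 2π/3
  -- applies. Below R the constant C absorbs the trivial bound |Φ| ≤ 1.
  set R : ℝ := 2 ^ (n₀ + 2) + 6 with hR
  have hR0 : 0 < R := by positivity
  set ρ := ρ₀ / c with hρ
  have hρ0 : 0 < ρ := by positivity
  set C := max C₀ (Real.exp (ρ * gfun σ R)) with hC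
  have hC0 : 0 < C := lt_of_lt_of_le hC₀ (le_max_left _ _)
  have key : ∀ ξ, 0 ≤ ξ → |realProd m₀ ξ| ≤ C * Real.exp (-ρ * gfun σ ξ) := by
    intro ξ hξ
    rcases le_or_gt ξ R with h | h
    · have h1 : gfun σ ξ ≤ gfun σ R :=
        gfun_mono hσ (by rwa [abs_of_nonneg hξ, abs_of_pos hR0])
      calc |realProd m₀ ξ| ≤ 1 := abs_realProd_le_one hm hcoz ξ
        _ ≤ Real.exp (ρ * gfun σ R) * Real.exp (-ρ * gfun σ ξ) := by
          rw [← Real.exp_add]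
          exact Real.one_le_exp (by nlinarith)
        _ ≤ _ := by gcongr; exact le_max_right _ _
    by_cases hne : realProd m₀ ξ = 0
    · rw [hne, abs_zero]; positivity
    have hξR : 8 * π / 5 ≤ ξ := by
      have : (0 : ℝ) < 2 ^ (n₀ + 2) := by positivity
      linarith [eight_pi_div_fifteen_lt]
    obtain ⟨n, hn, hu⟩ := exists_block_of_realProd_ne_zero hm hcoz hξR hne
    set u := ξ - 2 ^ n * (2 * π / 3) with hu'
    have hu2 : |u| < 2 := hu.trans eight_pi_div_fifteen_lt
    have hP : (0 : ℝ) < 2 ^ n := by positivity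
    have hP4 : (4 : ℝ) ≤ 2 ^ n := by
      calc (4 : ℝ) = 2 ^ 2 := by norm_num
        _ ≤ _ := pow_le_pow_right₀ one_le_two hn
    have hξn : ξ ≤ 2 ^ n * 4 := by
      have := (abs_lt.1 hu2).2
      nlinarith [Real.pi_lt_d2]
    have hnn : (2 : ℝ) ^ n₀ ≤ 2 ^ n := by
      have : (2 : ℝ) ^ (n₀ + 2) = 2 ^ n₀ * 4 := by ring
      linarith
    obtain ⟨k, rfl⟩ := Nat.exists_eq_add_of_le' hn
    have hfac := abs_realProd_le_factor hm hcoz ξ (k + 1)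
    have hval : ξ / 2 ^ (k + 1 + 1) = 2 * π / 3 + u / 2 ^ (k + 2) := by
      rw [hu']; field_simp; ring
    have hsmall : |u / 2 ^ (k + 2)| ≤ ε := by
      rw [abs_div, abs_of_pos hP, div_le_iff₀ hP]
      nlinarith
    rw [hval] at hfac
    refine (hfac.trans (hup _ hsmall)).trans ?_
    unfold ffun
    split_ifs with h0
    · rw [mul_zero]; positivity
    have hu0 : u ≠ 0 := by rintro h1; simp [h1] at h0
    -- The 8 comes from ξ ≤ 4·2^n and |u| < 2: together they give ξ/8 ≤ 2^n/|u|.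
    have hg : gfun σ ξ ≤ c * gfun σ (1 / (u / 2 ^ (k + 2))) := by
      have h1 : gfun σ ξ ≤ c * gfun σ (ξ / 8) := by
        have := gfun_mul_le (x := ξ / 8) hσ (by norm_num : (1 : ℝ) ≤ 8)
        rwa [mul_div_cancel₀ _ (by norm_num : (8 : ℝ) ≠ 0)] at this
      refine h1.trans ?_
      gcongr
      refine gfun_mono hσ ?_
      rw [one_div_div, abs_div, abs_div, abs_of_nonneg hξ, abs_of_pos hP,
        abs_of_pos (by norm_num : (0 : ℝ) < 8)]
      calc ξ / 8 ≤ 2 ^ (k + 2) / 2 := by linarith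
        _ ≤ _ := by gcongr
    have : ρ * gfun σ ξ ≤ ρ₀ * gfun σ (1 / (u / 2 ^ (k + 2))) := by
      calc ρ * gfun σ ξ ≤ ρ * (c * gfun σ (1 / (u / 2 ^ (k + 2)))) := by gcongr
        _ = _ := by rw [hρ]; field_simp
    exact mul_le_mul (le_max_left _ _) (Real.exp_le_exp.2 (by linarith)) (Real.exp_pos _).le hC0.le
  refine ⟨ρ, hρ0, C, hC0, fun ξ => ?_⟩
  rcases le_total 0 ξ with h | h
  · exact key ξ h
  · have := key (-ξ) (by linarith)
    rwa [realProd_neg hm, gfun_neg] at this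

theorem gfun_two_pow_div_le {σ r : ℝ} (hσ : 1 < σ) (hr : 0 < r) :
    ∃ D > 0, ∀ n : ℕ, 1 ≤ n → gfun σ (2 ^ n / r) ≤ D * (n : ℝ) ^ (σ / (σ - 1)) := by
  have hs : 0 < σ - 1 := by linarith
  set L := Real.log (1 + 1 / r) with hL
  have hL0 : 0 ≤ L := Real.log_nonneg (by have : 0 < 1 / r := by positivity
                                          linarith)
  refine ⟨(Real.exp 1 + 1 + L) ^ (σ / (σ - 1)), by positivity, fun n hn => ?_⟩
  have hn1 : (1 : ℝ) ≤ n := by exact_mod_cast hn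
  have hP1 : (1 : ℝ) ≤ 2 ^ n := one_le_pow₀ one_le_two
  have h0 : 0 ≤ Real.log (1 + |2 ^ n / r|) := Real.log_nonneg (by linarith [abs_nonneg (2 ^ n / r)])
  have h1 : Real.log (1 + |2 ^ n / r|) ≤ n + L := by
    rw [abs_of_nonneg (by positivity)]
    calc Real.log (1 + 2 ^ n / r) ≤ Real.log (2 ^ n * (1 + 1 / r)) := by
          apply Real.log_le_log (by positivity)
          rw [mul_add, mul_one_div]
          linarith
      _ = n * Real.log 2 + L := by
          rw [Real.log_mul (by positivity) (by positivity), Real.log_pow]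
      _ ≤ n + L := by nlinarith [Real.log_two_lt_d9]
  refine (omega_le hσ h0).trans ?_
  rw [← Real.mul_rpow (by positivity) (by positivity)]
  refine Real.rpow_le_rpow (by positivity) ?_ (by positivity)
  nlinarith [Real.exp_pos 1]

set_option maxHeartbeats 1000000 in
/-- Lower bound for the infinite product close to the points `2^n * 2π/3`. -/
theorem exists_lower_bound_realProd (hm : IsLowPassFilter m₀)
    (hcoz : Function.support m₀ ∩ Set.Icc 0 π ⊆ Set.Ico 0 (4 * π / 5)) {σ ε C₁ ρ₁ : ℝ}
    (hσ : 1 < σ) (hε : 0 < ε) (hC₁ : 0 < C₁) (hρ₁ : 0 < ρ₁) (hzero : m₀ (2 * π / 3) = 0)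
    (hlow : ∀ v, |v| ≤ ε → C₁ * ffun ρ₁ σ v ≤ |m₀ (2 * π / 3 + v)|) :
    ∃ r > 0, r ≤ 1 / 24 ∧ ∃ A > 0, ∀ n : ℕ, 1 ≤ n → ∀ u, 2 * r ≤ u → u ≤ 6 * r →
      Real.exp (-A * (n : ℝ) ^ (1 + σ / (σ - 1))) ≤ |realProd m₀ (2 ^ n * (2 * π / 3) + u)| := by
  have hs : 0 < σ - 1 := by linarith
  obtain ⟨d, hd, hd'⟩ : ∃ d > 0, ∀ v, |v| ≤ d → |m₀ (2 * π / 3 + v)| ≤ 1 / 2 := by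
    obtain ⟨d, hd, h⟩ := Metric.continuousAt_iff.1 (hm.continuous.continuousAt (x := 2 * π / 3))
      (1 / 2) (by norm_num)
    refine ⟨d / 2, by positivity, fun v hv => ?_⟩
    have := @h (2 * π / 3 + v) (by rw [Real.dist_eq, add_sub_cancel_left]; linarith)
    rw [hzero, Real.dist_eq, sub_zero] at this
    exact this.le
  -- The entries ε, d and 1/4 serve the lower bound near 2π/3, the last factor near π/3, and r ≤
  -- 1/24; the window [2r, 6r] ends at e and avoids the zero at u = 0.
  set e := min (min ε d) (1 / 4) with he
  have he0 : 0 < e := by positivity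
  have heε : e ≤ ε := (min_le_left _ _).trans (min_le_left _ _)
  have hed : e ≤ d := (min_le_left _ _).trans (min_le_right _ _)
  have he4 : e ≤ 1 / 4 := min_le_right _ _
  set r := e / 6 with hr
  have hr0 : 0 < r := by positivity
  obtain ⟨D, hD, hDn⟩ := gfun_two_pow_div_le (r := 2 * r) hσ (by positivity)
  set c := min C₁ 1 with hc
  have hc0 : 0 < c := by positivity
  have hlc : Real.log c ≤ 0 := Real.log_nonpos hc0.le (min_le_right _ _)
  refine ⟨r, hr0, by linarith, 1 - Real.log c + ρ₁ * D, ?_, fun n hn u hu1 hu2 => ?_⟩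
  · have : 0 < ρ₁ * D := by positivity
    linarith
  have hu0 : 0 < u := by linarith
  have hue : u ≤ e := by linarith
  have hn1 : (1 : ℝ) ≤ n := by exact_mod_cast hn
  have hπ3 := Real.pi_gt_d2
  have hπ4 := Real.pi_lt_d2
  have hP : (0 : ℝ) < 2 ^ n := by positivity
  have hP2 : (2 : ℝ) ≤ 2 ^ n := by
    calc (2 : ℝ) = 2 ^ 1 := by norm_num
      _ ≤ _ := pow_le_pow_right₀ one_le_two hn
  set ξ := 2 ^ n * (2 * π / 3) + u with hξ
  have hprod : realProd m₀ ξ = ∏ j ∈ Finset.range (n + 1), m₀ (ξ / 2 ^ (j + 1)) := by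
    refine realProd_eq_prod_range hm hcoz ?_
    rw [abs_of_pos (by positivity), hξ, show (2 : ℝ) ^ (n + 1 + 1) = 4 * 2 ^ n by ring]
    nlinarith
  -- The point π/3 + w is paired by the quadrature identity with 4π/3 + w, which reflects to 2π/3 -
  -- w, where |m₀| ≤ 1/2. All later factors equal 1.
  have hlast : 1 / 2 ≤ |m₀ (ξ / 2 ^ (n + 1))| := by
    set w := u / 2 ^ (n + 1) with hw
    have hw0 : 0 ≤ w := by positivity
    have hwd : w ≤ d := by
      rw [hw, div_le_iff₀ (by positivity), pow_succ]
      nlinarith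
    have hval : ξ / 2 ^ (n + 1) = π / 3 + w := by
      rw [hξ, hw]; field_simp; ring
    have hq := hm.qmf (π / 3 + w)
    have h2 : m₀ (π / 3 + w + π) = m₀ (2 * π / 3 + -w) := by
      rw [← hm.apply_two_pi_sub]; congr 1; ring
    have h3 := hd' (-w) (by rwa [abs_neg, abs_of_nonneg hw0])
    rw [h2] at hq
    rw [hval]
    by_contra! h
    nlinarith [abs_nonneg (m₀ (π / 3 + w)), abs_nonneg (m₀ (2 * π / 3 + -w))]
  set G := D * (n : ℝ) ^ (σ / (σ - 1)) with hG
  have hfac : ∀ j ∈ Finset.range n, c * Real.exp (-ρ₁ * G) ≤ |m₀ (ξ / 2 ^ (j + 1))| := by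
    intro j hj
    rw [Finset.mem_range] at hj
    set w := u / 2 ^ (j + 1) with hw
    have hQ : (0 : ℝ) < 2 ^ (j + 1) := by positivity
    have hQ1 : (1 : ℝ) ≤ 2 ^ (j + 1) := one_le_pow₀ one_le_two
    have hw0 : 0 < w := by positivity
    have hwe : w ≤ ε := by
      rw [hw, div_le_iff₀ hQ]
      nlinarith
    have hval : ξ / 2 ^ (j + 1) = 2 ^ (n - (j + 1)) * (2 * π / 3) + w := by
      have : (2 : ℝ) ^ n = 2 ^ (n - (j + 1)) * 2 ^ (j + 1) := by
        rw [← pow_add]; congr 1; omega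
      rw [hξ, hw, this]; field_simp
    have hgw : gfun σ (1 / w) ≤ G := by
      refine le_trans (gfun_mono hσ ?_) (hDn n hn)
      rw [hw, one_div_div, abs_of_pos (by positivity), abs_of_pos (by positivity)]
      gcongr
      · norm_num
      · omega
    have key : ∀ v, |v| = w → c * Real.exp (-ρ₁ * G) ≤ |m₀ (2 * π / 3 + v)| := by
      intro v hv
      refine le_trans ?_ (hlow v (by rw [hv]; exact hwe))
      have hv0 : v ≠ 0 := by rintro rfl; simp at hv; linarith
      have hgv : gfun σ (1 / v) = gfun σ (1 / w) := by
        simp only [gfun, abs_div, hv, abs_of_pos hw0]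
      rw [ffun, if_neg hv0, hgv]
      refine mul_le_mul (min_le_left _ _) (Real.exp_le_exp.2 ?_) (Real.exp_pos _).le hC₁.le
      nlinarith
    rw [hval]
    rcases two_pow_mod_three (n - (j + 1)) with ⟨m, h⟩ | ⟨m, h⟩
    · rw [hm.apply_of_mod_one h]
      exact key w (abs_of_pos hw0)
    · rw [hm.apply_of_mod_two h, sub_eq_add_neg]
      exact key (-w) (by rw [abs_neg, abs_of_pos hw0])
  rw [hprod, Finset.prod_range_succ, abs_mul, Finset.abs_prod]
  have h1 : (c * Real.exp (-ρ₁ * G)) ^ n ≤ ∏ j ∈ Finset.range n, |m₀ (ξ / 2 ^ (j + 1))| := by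
    calc (c * Real.exp (-ρ₁ * G)) ^ n
        = ∏ j ∈ Finset.range n, c * Real.exp (-ρ₁ * G) := by simp
      _ ≤ _ := Finset.prod_le_prod (fun _ _ => by positivity) hfac
  refine le_trans ?_ (mul_le_mul h1 hlast (by norm_num) (by positivity))
  have h2 : (c * Real.exp (-ρ₁ * G)) ^ n = Real.exp (n * (Real.log c - ρ₁ * G)) := by
    rw [Real.exp_nat_mul, Real.exp_sub, Real.exp_log hc0, neg_mul, Real.exp_neg, div_eq_mul_inv]
  have h3 : Real.exp (-1) ≤ 1 / 2 := by
    rw [Real.exp_neg, one_div]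
    exact inv_anti₀ (by norm_num) (by linarith [Real.add_one_le_exp (1 : ℝ)])
  refine le_trans ?_ (mul_le_mul_of_nonneg_left h3 (by positivity))
  rw [h2, ← Real.exp_add]
  apply Real.exp_le_exp.2
  have hns : (n : ℝ) ^ (1 + σ / (σ - 1)) = n * (n : ℝ) ^ (σ / (σ - 1)) := by
    rw [Real.rpow_add (by positivity), Real.rpow_one]
  have hn2 : (n : ℝ) ≤ (n : ℝ) ^ (1 + σ / (σ - 1)) := by
    rw [hns]
    exact le_mul_of_one_le_right (by positivity) (Real.one_le_rpow hn1 (by positivity))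
  have h4 : (n : ℝ) * (ρ₁ * G) = ρ₁ * D * (n : ℝ) ^ (1 + σ / (σ - 1)) := by
    rw [hns, hG]; ring
  rw [mul_sub, h4]
  nlinarith

/-- Points of the support of the product outside the `n`-th block are far from that block. -/
theorem le_abs_sub_of_realProd_ne_zero (hm : IsLowPassFilter m₀)
    (hcoz : Function.support m₀ ∩ Set.Icc 0 π ⊆ Set.Ico 0 (4 * π / 5)) {n : ℕ} (hn : 4 ≤ n)
    {ξ t : ℝ} (ht0 : 0 ≤ t) (ht : t ≤ 1) (hne : realProd m₀ ξ ≠ 0)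
    (hfar : 4 < |ξ - (2 ^ n * (2 * π / 3) + t)|) :
    (|ξ| + 2 ^ n) / 8 ≤ |ξ - (2 ^ n * (2 * π / 3) + t)| := by
  have hπ3 := Real.pi_gt_d2
  have hπ4 := Real.pi_lt_d2
  have hP : (16 : ℝ) ≤ 2 ^ n := by
    calc (16 : ℝ) = 2 ^ 4 := by norm_num
      _ ≤ _ := pow_le_pow_right₀ one_le_two hn
  have hX1 : 2 * 2 ^ n ≤ 2 ^ n * (2 * π / 3) := by nlinarith
  have hX2 : 2 ^ n * (2 * π / 3) ≤ 2.1 * 2 ^ n := by nlinarith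
  rcases le_or_gt (8 * π / 5) ξ with h | h
  · obtain ⟨m, hm2, hu⟩ := exists_block_of_realProd_ne_zero hm hcoz h hne
    have hu2 := abs_lt.1 (hu.trans eight_pi_div_fifteen_lt)
    have hQ : (4 : ℝ) ≤ 2 ^ m := by
      calc (4 : ℝ) = 2 ^ 2 := by norm_num
        _ ≤ _ := pow_le_pow_right₀ one_le_two hm2
    have hY1 : 2 * 2 ^ m ≤ 2 ^ m * (2 * π / 3) := by nlinarith
    have hY2 : 2 ^ m * (2 * π / 3) ≤ 2.1 * 2 ^ m := by nlinarith
    rw [abs_of_nonneg (by linarith : 0 ≤ ξ)]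
    rcases lt_trichotomy m n with hmn | hmn | hmn
    · have : (2 : ℝ) * 2 ^ m ≤ 2 ^ n := by
        rw [← pow_succ']; exact pow_le_pow_right₀ one_le_two hmn
      rw [abs_sub_comm]
      refine le_trans ?_ (le_abs_self _)
      nlinarith
    · subst hmn
      exfalso
      have : |ξ - (2 ^ m * (2 * π / 3) + t)| ≤ 4 := by
        rw [abs_le]; constructor <;> linarith
      linarith
    · have : (2 : ℝ) * 2 ^ n ≤ 2 ^ m := by
        rw [← pow_succ']; exact pow_le_pow_right₀ one_le_two hmn
      refine le_trans ?_ (le_abs_self _)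
      nlinarith
  · rw [abs_sub_comm]
    refine le_trans ?_ (le_abs_self _)
    rcases abs_cases ξ with ⟨h1, h2⟩ | ⟨h1, h2⟩ <;> rw [h1] <;> linarith

/-! ### Averages and second differences of Fourier integrals -/

/-- The Fourier integral `∫ F(v) e^{ixv} dv`. -/
def fourierInt (F : ℝ → ℂ) (x : ℝ) : ℂ := ∫ v : ℝ, F v * Complex.exp (((x * v : ℝ) : ℂ) * Complex.I)

/-- The Fourier multiplier of `1 + κ δ⁻² Δ_δ`, where `Δ_δ` is the second central difference. -/
def diffMult (κ δ v : ℝ) : ℝ := 1 - κ * (2 - 2 * Real.cos (δ * v)) / δ ^ 2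

theorem integrable_mul_exp {F : ℝ → ℂ} (hF : Integrable F) (x : ℝ) :
    Integrable fun v : ℝ => F v * Complex.exp (((x * v : ℝ) : ℂ) * Complex.I) :=
  hF.mul_bdd (c := 1) (by fun_prop)
    (ae_of_all _ fun v => (Complex.norm_exp_ofReal_mul_I _).le)

theorem continuous_diffMult (κ δ : ℝ) : Continuous (diffMult κ δ) := by
  unfold diffMult; fun_prop

theorem abs_diffMult_le {κ δ : ℝ} (hκ : 0 ≤ κ) (v : ℝ) :
    |diffMult κ δ v| ≤ 1 + 4 * κ / δ ^ 2 := by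
  have h1 := Real.neg_one_le_cos (δ * v)
  have h2 := Real.cos_le_one (δ * v)
  have h3 : κ * (2 - 2 * Real.cos (δ * v)) / δ ^ 2 ≤ 4 * κ / δ ^ 2 := by
    refine div_le_div_of_nonneg_right ?_ (by positivity)
    nlinarith
  have h4 : 0 ≤ κ * (2 - 2 * Real.cos (δ * v)) / δ ^ 2 :=
    div_nonneg (mul_nonneg hκ (by linarith)) (by positivity)
  unfold diffMult
  rw [abs_le]
  constructor <;> linarith

theorem integrable_mul_sinc {F : ℝ → ℂ} (hF : Integrable F) (δ : ℝ) :
    Integrable fun v : ℝ => F v * (Real.sinc (δ * v) : ℂ) :=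
  hF.mul_bdd (c := 1)
    (Complex.continuous_ofReal.comp
      (Real.continuous_sinc.comp (by fun_prop))).aestronglyMeasurable
    (ae_of_all _ fun v => by
      rw [Complex.norm_real, Real.norm_eq_abs]; exact Real.abs_sinc_le_one _)

theorem integrable_mul_diffMult {F : ℝ → ℂ} (hF : Integrable F) {κ : ℝ} (hκ : 0 ≤ κ) (δ : ℝ) :
    Integrable fun v : ℝ => F v * (diffMult κ δ v : ℂ) :=
  hF.mul_bdd (c := 1 + 4 * κ / δ ^ 2)
    (Complex.continuous_ofReal.comp (continuous_diffMult κ δ)).aestronglyMeasurable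
    (ae_of_all _ fun v => by
      rw [Complex.norm_real, Real.norm_eq_abs]; exact abs_diffMult_le hκ _)

/-- Fubini together with ∫_{-δ}^{δ} e^{ivt} dt = 2δ sinc(δv): the sinc multiplier is an average over
a window of radius δ. -/
theorem fourierInt_mul_sinc {F : ℝ → ℂ} (hF : Integrable F) (δ x : ℝ) :
    2 * δ * fourierInt (fun v => F v * (Real.sinc (δ * v) : ℂ)) x =
      ∫ t in (-δ)..δ, fourierInt F (x + t) := by
  unfold fourierInt
  rw [intervalIntegral_integral_swap, ← integral_const_mul]
  · congr 1
    ext v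
    have h1 : ∀ t : ℝ, F v * Complex.exp ((((x + t) * v : ℝ) : ℂ) * Complex.I) =
        F v * Complex.exp (((x * v : ℝ) : ℂ) * Complex.I) * Complex.exp (((v * t : ℝ) : ℂ) * Complex.I) := by
      intro t
      rw [mul_assoc, ← Complex.exp_add]
      congr 2
      push_cast
      ring
    simp_rw [h1]
    rw [intervalIntegral.integral_const_mul]
    have h2 : ∫ t in (-δ)..δ, Complex.exp (((v * t : ℝ) : ℂ) * Complex.I) =
        2 * δ * Real.sinc (δ * v) := by
      rcases eq_or_ne v 0 with rfl | hv
      · simp; ring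
      have := intervalIntegral.integral_comp_mul_left
        (fun s : ℝ => Complex.exp ((s : ℂ) * Complex.I)) hv (a := -δ) (b := δ)
      rw [this, mul_neg, integral_exp_mul_I_eq_sinc, mul_comm δ v, Complex.real_smul]
      push_cast
      have hv' : (v : ℂ) ≠ 0 := by exact_mod_cast hv
      field_simp
    rw [h2]
    ring
  · have : IsFiniteMeasure (volume.restrict (Set.uIoc (-δ) δ)) :=
      ⟨by simp [Set.uIoc]⟩
    refine (hF.comp_snd (volume.restrict (Set.uIoc (-δ) δ))).mul_bdd (c := 1) ?_
      (ae_of_all _ fun v => (Complex.norm_exp_ofReal_mul_I _).le)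
    exact Continuous.aestronglyMeasurable (by fun_prop)

theorem norm_fourierInt_mul_sinc_le {F : ℝ → ℂ} (hF : Integrable F) {δ r B : ℝ} (hδ : 0 < δ)
    (h : ∀ y, |y| ≤ r + δ → ‖fourierInt F y‖ ≤ B) {x : ℝ} (hx : |x| ≤ r) :
    ‖fourierInt (fun v => F v * (Real.sinc (δ * v) : ℂ)) x‖ ≤ B := by
  have h1 : ‖∫ t in (-δ)..δ, fourierInt F (x + t)‖ ≤ B * |δ - -δ| := by
    refine intervalIntegral.norm_integral_le_of_norm_le_const fun t ht => h _ ?_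
    rw [Set.uIoc_of_le (by linarith)] at ht
    have : |t| ≤ δ := abs_le.2 ⟨ht.1.le, ht.2⟩
    exact (abs_add_le x t).trans (add_le_add hx this)
  rw [← fourierInt_mul_sinc hF, norm_mul, sub_neg_eq_add, abs_of_pos (by positivity)] at h1
  have h2 : ‖(2 * δ : ℂ)‖ = 2 * δ := by
    rw [show (2 * δ : ℂ) = ((2 * δ : ℝ) : ℂ) by push_cast; rfl, Complex.norm_real,
      Real.norm_of_nonneg (by positivity)]
  rw [h2] at h1
  nlinarith

theorem fourierInt_mul_diffMult {F : ℝ → ℂ} (hF : Integrable F) (κ δ x : ℝ) :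
    fourierInt (fun v => F v * (diffMult κ δ v : ℂ)) x =
      ((1 - 2 * κ / δ ^ 2 : ℝ) : ℂ) * fourierInt F x +
        ((κ / δ ^ 2 : ℝ) : ℂ) * (fourierInt F (x + δ) + fourierInt F (x - δ)) := by
  unfold fourierInt
  have i1 := integrable_mul_exp hF x
  have i2 := integrable_mul_exp hF (x + δ)
  have i3 := integrable_mul_exp hF (x - δ)
  rw [← integral_add i2 i3, ← integral_const_mul, ← integral_const_mul]
  refine Eq.trans ?_ (integral_add (i1.const_mul _) ((i2.add i3).const_mul _))
  congr 1
  ext v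
  have e1 : Complex.exp ((((x + δ) * v : ℝ) : ℂ) * Complex.I) =
      Complex.exp (((x * v : ℝ) : ℂ) * Complex.I) * Complex.exp (((δ * v : ℝ) : ℂ) * Complex.I) := by
    rw [← Complex.exp_add]; congr 1; push_cast; ring
  have e2 : Complex.exp ((((x - δ) * v : ℝ) : ℂ) * Complex.I) =
      Complex.exp (((x * v : ℝ) : ℂ) * Complex.I) *
        Complex.exp (-((δ * v : ℝ) : ℂ) * Complex.I) := by
    rw [← Complex.exp_add]; congr 1; push_cast; ring
  have e3 : (Real.cos (δ * v) : ℂ) = (Complex.exp (((δ * v : ℝ) : ℂ) * Complex.I) +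
      Complex.exp (-((δ * v : ℝ) : ℂ) * Complex.I)) / 2 := by
    rw [Complex.ofReal_cos, Complex.cos]
  rw [e1, e2]
  unfold diffMult
  push_cast [e3]
  ring

theorem norm_fourierInt_mul_diffMult_le {F : ℝ → ℂ} (hF : Integrable F) {κ δ r B : ℝ}
    (hκ : 0 ≤ κ) (hδ : 0 < δ) (h : ∀ y, |y| ≤ r + δ → ‖fourierInt F y‖ ≤ B) {x : ℝ}
    (hx : |x| ≤ r) :
    ‖fourierInt (fun v => F v * (diffMult κ δ v : ℂ)) x‖ ≤ (1 + 4 * κ / δ ^ 2) * B := by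
  rw [fourierInt_mul_diffMult hF]
  have h1 := h x (by linarith)
  have h2 := h (x + δ) ((abs_add_le x δ).trans (by rw [abs_of_pos hδ]; linarith))
  have h3 := h (x - δ) ((abs_sub x δ).trans (by rw [abs_of_pos hδ]; linarith))
  have hB : 0 ≤ B := (norm_nonneg _).trans h1
  have hk : 0 ≤ κ / δ ^ 2 := by positivity
  have h4 : |1 - 2 * κ / δ ^ 2| ≤ 1 + 2 * (κ / δ ^ 2) := by
    rw [mul_div_assoc, abs_le]; constructor <;> linarith
  calc _ ≤ |1 - 2 * κ / δ ^ 2| * ‖fourierInt F x‖ +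
        (κ / δ ^ 2) * (‖fourierInt F (x + δ)‖ + ‖fourierInt F (x - δ)‖) := by
        refine (norm_add_le _ _).trans ?_
        rw [norm_mul, norm_mul, Complex.norm_real, Complex.norm_real, Real.norm_eq_abs,
          Real.norm_of_nonneg hk]
        gcongr
        exact norm_add_le _ _
    _ ≤ (1 + 2 * (κ / δ ^ 2)) * B + (κ / δ ^ 2) * (B + B) := by gcongr
    _ = _ := by ring

/-- Each averaging needs δ more room and leaves the bound unchanged. -/
theorem norm_fourierInt_mul_sinc_pow_le {δ : ℝ} (hδ : 0 < δ) (M : ℕ) :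
    ∀ {F : ℝ → ℂ} (_ : Integrable F) {r B : ℝ} (_ : ∀ y, |y| ≤ r + M * δ → ‖fourierInt F y‖ ≤ B),
      Integrable (fun v => F v * ((Real.sinc (δ * v) ^ M : ℝ) : ℂ)) ∧
      ∀ x, |x| ≤ r → ‖fourierInt (fun v => F v * ((Real.sinc (δ * v) ^ M : ℝ) : ℂ)) x‖ ≤ B := by
  induction M with
  | zero => intro F hF r B h; simpa using! ⟨hF, by simpa using h⟩
  | succ M ih =>
    intro F hF r B h
    have h1 := ih (integrable_mul_sinc hF δ) (r := r) (B := B) fun y hy =>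
      norm_fourierInt_mul_sinc_le hF hδ (r := r + M * δ)
        (fun z hz => h z (by push_cast; linarith)) hy
    have e : ∀ v, F v * ((Real.sinc (δ * v) ^ (M + 1) : ℝ) : ℂ) =
        F v * (Real.sinc (δ * v) : ℂ) * ((Real.sinc (δ * v) ^ M : ℝ) : ℂ) := by
      intro v; push_cast; ring
    simp_rw [e]
    exact h1

/-- Each difference needs δ more room and costs the sum of its absolute coefficients, at most 1 +
4κ/δ². -/
theorem norm_fourierInt_mul_diffMult_pow_le {κ δ : ℝ} (hκ : 0 ≤ κ) (hδ : 0 < δ) (N : ℕ) :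
    ∀ {F : ℝ → ℂ} (_ : Integrable F) {r B : ℝ} (_ : ∀ y, |y| ≤ r + N * δ → ‖fourierInt F y‖ ≤ B),
      ∀ x, |x| ≤ r → ‖fourierInt (fun v => F v * ((diffMult κ δ v ^ N : ℝ) : ℂ)) x‖ ≤
        (1 + 4 * κ / δ ^ 2) ^ N * B := by
  induction N with
  | zero => intro F hF r B h; simpa using h
  | succ N ih =>
    intro F hF r B h x hx
    have h1 := ih (integrable_mul_diffMult hF hκ δ) (r := r) (B := (1 + 4 * κ / δ ^ 2) * B)
      (fun y hy => norm_fourierInt_mul_diffMult_le hF hκ hδ (r := r + N * δ)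
        (fun z hz => h z (by push_cast; linarith)) hy) x hx
    have e : ∀ v, F v * ((diffMult κ δ v ^ (N + 1) : ℝ) : ℂ) =
        F v * (diffMult κ δ v : ℂ) * ((diffMult κ δ v ^ N : ℝ) : ℂ) := by
      intro v; push_cast; ring
    simp_rw [e]
    rw [pow_succ, mul_assoc]
    exact h1

/-- A bound for a Fourier integral near the origin controls its pairing with a multiplier that is
the symbol of an operator of small support. -/
theorem norm_integral_mul_multiplier_le {F : ℝ → ℂ} (hF : Integrable F) {κ δ B : ℝ} (hκ : 0 ≤ κ)
    (hδ : 0 < δ) {M N : ℕ} (h : ∀ y, |y| ≤ (M + N) * δ → ‖fourierInt F y‖ ≤ B) :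
    ‖∫ v, F v * ((Real.sinc (δ * v) ^ M * diffMult κ δ v ^ N : ℝ) : ℂ)‖ ≤
      (1 + 4 * κ / δ ^ 2) ^ N * B := by
  -- The averages shrink the radius from (M+N)δ to Nδ and the differences from there to 0, where the
  -- Fourier integral is the plain integral.
  obtain ⟨h1, h2⟩ := norm_fourierInt_mul_sinc_pow_le hδ M hF (r := N * δ) (B := B)
    fun y hy => h y (by linarith)
  have h3 := norm_fourierInt_mul_diffMult_pow_le hκ hδ N h1 (r := 0) (B := B)
    (fun y hy => h2 y (by linarith)) 0 (by simp)
  unfold fourierInt at h3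
  convert h3 using 3
  simp [mul_assoc]

/-! ### Size of the multipliers -/

theorem abs_sinc_mul_le_inv {δ v : ℝ} (hδ : 0 < δ) (hv : v ≠ 0) :
    |Real.sinc (δ * v)| ≤ (δ * |v|)⁻¹ := by
  have h : δ * v ≠ 0 := by positivity
  rw [Real.sinc_of_ne_zero h, abs_div, abs_mul, abs_of_pos hδ, ← one_div]
  gcongr
  exact Real.abs_sin_le_one _

theorem one_sub_sq_le_sinc {x : ℝ} (hx : |x| ≤ 1) : 1 - x ^ 2 / 4 ≤ Real.sinc x := by
  have key : ∀ y, 0 < y → y ≤ 1 → 1 - y ^ 2 / 4 ≤ Real.sinc y := by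
    intro y h0 h1
    rw [Real.sinc_of_ne_zero h0.ne', le_div_iff₀ h0]
    have := Real.sin_gt_sub_cube h0
    nlinarith [pow_pos h0 3]
  rcases lt_trichotomy x 0 with h | h | h
  · have := key (-x) (by linarith) (by linarith [neg_abs_le x])
    rwa [Real.sinc_neg, neg_sq] at this
  · simp [h]
  · exact key x h (by linarith [le_abs_self x])

/-- By Bernoulli, (1 - 4δ²)^M ≥ 1 - 4Mδ² ≥ 1 - 4δ ≥ 1/2, since Mδ ≤ 1 and δ ≤ 1/8. -/
theorem half_le_sinc_pow {δ v : ℝ} {M : ℕ} (hM : 8 ≤ M) (hδ : 0 < δ) (hδM : M * δ ≤ 1)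
    (hv : |v| ≤ 4) : 1 / 2 ≤ Real.sinc (δ * v) ^ M := by
  have hM' : (8 : ℝ) ≤ M := by exact_mod_cast hM
  have hδ8 : 8 * δ ≤ 1 := by nlinarith
  have h1 : |δ * v| ≤ 4 * δ := by rw [abs_mul, abs_of_pos hδ]; nlinarith
  have h2 : (δ * v) ^ 2 ≤ (4 * δ) ^ 2 := sq_le_sq' (by linarith [(abs_le.1 h1).1]) (abs_le.1 h1).2
  have h3 := one_sub_sq_le_sinc (x := δ * v) (by linarith)
  have h4 : 1 - 4 * δ ^ 2 ≤ Real.sinc (δ * v) := by nlinarith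
  have h5 : 1 + (M : ℝ) * (-(4 * δ ^ 2)) ≤ (1 + -(4 * δ ^ 2)) ^ M :=
    one_add_mul_le_pow (by nlinarith) M
  have h6 : (1 + -(4 * δ ^ 2)) ^ M ≤ Real.sinc (δ * v) ^ M :=
    pow_le_pow_left₀ (by nlinarith) (by linarith) M
  nlinarith

theorem one_sub_le_diffMult {κ δ v : ℝ} (hκ : 0 ≤ κ) (hδ : 0 < δ) :
    1 - κ * v ^ 2 ≤ diffMult κ δ v := by
  have h := Real.one_sub_sq_div_two_le_cos (x := δ * v)
  unfold diffMult
  have : κ * (2 - 2 * Real.cos (δ * v)) / δ ^ 2 ≤ κ * v ^ 2 := by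
    rw [div_le_iff₀ (by positivity)]
    nlinarith
  linarith

/-- From 1 - cos x ≥ 2x²/π² and π² ≤ 10 one gets the factor 8/5 > 3/2. The gap to the lower bound 1
- κr² on |v| ≤ r is what singles out the middle of a block after N powers. -/
theorem diffMult_le {κ δ v r : ℝ} (hκ : 0 ≤ κ) (hδ : 0 < δ) (hr : 0 ≤ r) (h1 : 2 * r ≤ |v|)
    (h2 : δ * |v| ≤ π) : diffMult κ δ v ≤ 1 - 3 / 2 * (κ * r ^ 2) := by
  have h := Real.cos_le_one_sub_mul_cos_sq (x := δ * v) (by rwa [abs_mul, abs_of_pos hδ])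
  have hπ : π ^ 2 ≤ 10 := by nlinarith [Real.pi_lt_d2, Real.pi_pos]
  have h5 : 1 / 5 ≤ 2 / π ^ 2 := by
    rw [le_div_iff₀ (by positivity)]; linarith
  have hv : 4 * r ^ 2 ≤ v ^ 2 := by
    rw [← sq_abs v]; nlinarith
  have h6 : 1 / 5 * (δ * v) ^ 2 ≤ 2 / π ^ 2 * (δ * v) ^ 2 := by gcongr
  have h7 : 8 / 5 * r ^ 2 * δ ^ 2 ≤ 2 - 2 * Real.cos (δ * v) := by
    have : r ^ 2 * 4 * δ ^ 2 ≤ v ^ 2 * δ ^ 2 := by nlinarith [sq_nonneg δ]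
    nlinarith
  have : 3 / 2 * (κ * r ^ 2) ≤ κ * (2 - 2 * Real.cos (δ * v)) / δ ^ 2 := by
    rw [le_div_iff₀ (by positivity)]
    have : κ * (8 / 5 * r ^ 2 * δ ^ 2) ≤ κ * (2 - 2 * Real.cos (δ * v)) := by gcongr
    have : 0 ≤ κ * (r ^ 2 * δ ^ 2) := by positivity
    linarith
  unfold diffMult
  linarith

/-! ### Localization of the product in one block -/

theorem exists_sign_mul_eq_abs {f : ℝ → ℝ} (hf : Continuous f) {x y : ℝ}
    (hne : ∀ u, x ≤ u → u ≤ y → f u ≠ 0) :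
    ∃ s : ℝ, |s| = 1 ∧ ∀ u, x ≤ u → u ≤ y → s * f u = |f u| := by
  by_cases hxy : x ≤ y
  swap
  · exact ⟨1, abs_one, fun u h1 h2 => absurd (h1.trans h2) hxy⟩
  have hiv : ∀ u, x ≤ u → u ≤ y → ¬ (0 ∈ Set.uIcc (f x) (f u)) := by
    intro u h1 h2 h
    obtain ⟨z, hz, hz0⟩ := intermediate_value_uIcc hf.continuousOn h
    rw [Set.uIcc_of_le h1] at hz
    exact hne z hz.1 (hz.2.trans h2) hz0
  rcases (hne x le_rfl hxy).lt_or_gt with h | h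
  · refine ⟨-1, by simp, fun u h1 h2 => ?_⟩
    have : f u < 0 := by
      by_contra! h3
      exact hiv u h1 h2 (Set.mem_uIcc.2 (Or.inl ⟨h.le, h3⟩))
    rw [abs_of_neg this]; ring
  · refine ⟨1, abs_one, fun u h1 h2 => ?_⟩
    have : 0 < f u := by
      by_contra! h3
      exact hiv u h1 h2 (Set.mem_uIcc.2 (Or.inr ⟨h3, h.le⟩))
    rw [abs_of_pos this, one_mul]

/-- The 3N powers of decay are shared out: p ≤ N absorb y^p, N give the gain P^{-N}, and two give
integrability. -/
theorem far_weight_le {y w d P : ℝ} {N p : ℕ} (hN : 2 ≤ N) (hp : p ≤ N) (hy : 0 ≤ y)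
    (hP : 1 ≤ P) (hw : 0 ≤ w) (hwd : w ≤ (1 / (4 * N) * d)⁻¹) (hd : (y + P) / 8 ≤ d) :
    y ^ p * w ^ (3 * N) ≤ (32 * N) ^ (3 * N) * (P ^ N)⁻¹ * ((1 + y) ^ 2)⁻¹ := by
  have hN0 : (0 : ℝ) < N := by exact_mod_cast (by omega : 0 < N)
  have hY : 0 < y + P := by linarith
  have h1 : w ≤ 32 * N / (y + P) := by
    refine hwd.trans ?_
    rw [mul_inv, one_div, inv_inv, ← div_eq_mul_inv]
    have hd0 : 0 < d := by linarith [div_pos hY (by norm_num : (0 : ℝ) < 8)]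
    rw [div_le_div_iff₀ hd0 hY]
    nlinarith
  have h2 : w ^ (3 * N) ≤ (32 * N) ^ (3 * N) / (y + P) ^ (3 * N) := by
    rw [← div_pow]; exact pow_le_pow_left₀ hw h1 _
  have h3 : y ^ p * ((1 + y) ^ 2 * P ^ N) ≤ (y + P) ^ (3 * N) := by
    calc y ^ p * ((1 + y) ^ 2 * P ^ N) ≤ (y + P) ^ p * ((y + P) ^ 2 * (y + P) ^ N) := by
          have a1 := pow_le_pow_left₀ hy (by linarith : y ≤ y + P) p
          have a2 := pow_le_pow_left₀ (by linarith) (by linarith : 1 + y ≤ y + P) 2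
          have a3 := pow_le_pow_left₀ (by linarith) (by linarith : P ≤ y + P) N
          exact mul_le_mul a1 (mul_le_mul a2 a3 (by positivity) (by positivity))
            (by positivity) (by positivity)
      _ = (y + P) ^ (p + (2 + N)) := by ring
      _ ≤ _ := pow_le_pow_right₀ (by linarith) (by omega)
  calc y ^ p * w ^ (3 * N) ≤ y ^ p * ((32 * N) ^ (3 * N) / (y + P) ^ (3 * N)) := by gcongr
    _ = (32 * N) ^ (3 * N) * (P ^ N)⁻¹ * ((1 + y) ^ 2)⁻¹ *
        (y ^ p * ((1 + y) ^ 2 * P ^ N) / (y + P) ^ (3 * N)) := by field_simp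
    _ ≤ _ := mul_le_of_le_one_right (by positivity) (by rw [div_le_one (by positivity)]; exact h3)

/-- Pointwise form of the localization: up to a sign, the weighted product is bounded from below by
its value in the middle of the block minus small errors. -/
theorem pointwise_lower_bound (hm : IsLowPassFilter m₀)
    (hcoz : Function.support m₀ ∩ Set.Icc 0 π ⊆ Set.Ico 0 (4 * π / 5)) {r b s : ℝ} (hr : 0 < r)
    (hr' : r ≤ 1 / 24) {n N p : ℕ} (hn : 4 ≤ n) (hN : 8 ≤ N) (hp : p ≤ N) (hs : |s| = 1)
    (hb0 : 0 < b)
    (hb : ∀ u, 2 * r ≤ u → u ≤ 6 * r → b ≤ |realProd m₀ (2 ^ n * (2 * π / 3) + u)|)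
    (hsign : ∀ u, 2 * r ≤ u → u ≤ 6 * r → s * realProd m₀ (2 ^ n * (2 * π / 3) + u) =
      |realProd m₀ (2 ^ n * (2 * π / 3) + u)|) (v : ℝ) :
    (Set.Icc (-r) r).indicator
        (fun _ => (2 ^ n * (2 * π / 3)) ^ p * b / 2 * (1 - r ^ 2 / 16) ^ N) v
      - (Set.Icc (-4) 4).indicator
        (fun _ => (2 ^ n * (2 * π / 3) + 5) ^ p * (1 - 3 / 2 * (r ^ 2 / 16)) ^ N) v
      - (1 + 4 * (N : ℝ) ^ 2) ^ N * ((32 * N) ^ (3 * N) * ((2 ^ n) ^ N)⁻¹) *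
          ((1 + |v + (2 ^ n * (2 * π / 3) + 4 * r)|) ^ 2)⁻¹ ≤
      s * ((v + (2 ^ n * (2 * π / 3) + 4 * r)) ^ p *
        realProd m₀ (v + (2 ^ n * (2 * π / 3) + 4 * r)) *
        (Real.sinc (1 / (4 * N) * v) ^ (3 * N) * diffMult (1 / 16) (1 / (4 * N)) v ^ N)) := by
  have hN0 : (8 : ℝ) ≤ N := by exact_mod_cast hN
  have hNpos : (0 : ℝ) < N := by linarith
  set X : ℝ := 2 ^ n * (2 * π / 3) with hX
  have hX0 : 0 < X := by positivity
  set ξ := v + (X + 4 * r) with hξ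
  set δ : ℝ := 1 / (4 * N) with hδ
  have hδ0 : 0 < δ := by positivity
  have hδN : ((3 * N : ℕ) : ℝ) * δ ≤ 1 := by
    rw [hδ]; push_cast; rw [mul_one_div, div_le_one (by positivity)]; linarith
  have hδ4 : δ * 4 ≤ π := by
    have : δ ≤ 1 / 4 := by
      rw [hδ]; apply one_div_le_one_div_of_le <;> linarith
    linarith [Real.pi_gt_three]
  have hr2 : r ^ 2 ≤ 1 := by nlinarith
  set m : ℝ := X ^ p * b / 2 * (1 - r ^ 2 / 16) ^ N with hmdef
  have hm0 : 0 ≤ m := mul_nonneg (by positivity) (pow_nonneg (by linarith) _)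
  set c : ℝ := (X + 5) ^ p * (1 - 3 / 2 * (r ^ 2 / 16)) ^ N with hcdef
  have hc0 : 0 ≤ c := mul_nonneg (by positivity) (pow_nonneg (by linarith) _)
  set k : ℝ := (1 + 4 * (N : ℝ) ^ 2) ^ N * ((32 * N) ^ (3 * N) * ((2 ^ n) ^ N)⁻¹) with hkdef
  have hk0 : 0 ≤ k * ((1 + |ξ|) ^ 2)⁻¹ := by positivity
  set S := Real.sinc (δ * v) ^ (3 * N) with hS
  set q := diffMult (1 / 16) δ v with hq
  have hind : 0 ≤ (Set.Icc (-4 : ℝ) 4).indicator (fun _ => c) v :=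
    Set.indicator_nonneg (fun _ _ => hc0) v
  have hgone := abs_realProd_le_one hm hcoz ξ
  have hSabs : |S| ≤ 1 := by
    rw [hS, abs_pow]; exact pow_le_one₀ (abs_nonneg _) (Real.abs_sinc_le_one _)
  have habs : |s * (ξ ^ p * realProd m₀ ξ * (S * q ^ N))| =
      |ξ| ^ p * |realProd m₀ ξ| * (|S| * |q| ^ N) := by
    simp only [abs_mul, abs_pow, hs, one_mul]
  rcases le_or_gt |v| 4 with h4 | h4
  · have hv := abs_le.1 h4
    have hShalf : 1 / 2 ≤ S := half_le_sinc_pow (by omega) hδ0 hδN h4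
    -- The value κ = 1/16 makes 1 - κv² ≥ 0 on |v| ≤ 4.
    have hq0 : 0 ≤ q := by
      refine le_trans ?_ (one_sub_le_diffMult (by norm_num) hδ0)
      nlinarith
    -- For |v| ≤ 2r the argument stays in the window of constant sign: the main term comes from |v|
    -- ≤ r, and r < |v| ≤ 2r contributes nonnegatively. For 2r < |v| ≤ 4 the difference powers make
    -- the integrand small.
    rcases le_or_gt |v| (2 * r) with h2 | h2
    · have hv2 := abs_le.1 h2
      have hξu : ξ = X + (4 * r + v) := by rw [hξ]; ring
      have hu1 : 2 * r ≤ 4 * r + v := by linarith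
      have hu2 : 4 * r + v ≤ 6 * r := by linarith
      have hval : s * (ξ ^ p * realProd m₀ ξ * (S * q ^ N)) =
          ξ ^ p * |realProd m₀ ξ| * (S * q ^ N) := by
        have := hsign _ hu1 hu2
        rw [← hξu] at this
        rw [← this]; ring
      have hξX : X ≤ ξ := by linarith
      have hξ0 : 0 ≤ ξ := by linarith
      rw [hval]
      have hnn : 0 ≤ ξ ^ p * |realProd m₀ ξ| * (S * q ^ N) := by
        have : 0 ≤ S := by linarith
        positivity
      by_cases h1 : v ∈ Set.Icc (-r) r
      · rw [Set.indicator_of_mem h1]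
        have hv1 : v ^ 2 ≤ r ^ 2 := sq_le_sq' h1.1 h1.2
        have hqr : 1 - r ^ 2 / 16 ≤ q := by
          refine le_trans ?_ (one_sub_le_diffMult (by norm_num) hδ0)
          linarith
        have hbb := hb _ hu1 hu2
        rw [← hξu] at hbb
        have : m ≤ ξ ^ p * |realProd m₀ ξ| * (S * q ^ N) := by
          calc m = X ^ p * b * (1 / 2 * (1 - r ^ 2 / 16) ^ N) := by rw [hmdef]; ring
            _ ≤ _ := by
              have : 0 ≤ 1 - r ^ 2 / 16 := by linarith
              gcongr
        linarith
      · rw [Set.indicator_of_notMem h1]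
        linarith
    · have h1 : v ∉ Set.Icc (-r) r := by
        intro h
        have := abs_le.2 h
        linarith
      rw [Set.indicator_of_notMem h1, Set.indicator_of_mem (show v ∈ Set.Icc (-4) 4 from hv)]
      have hqle : q ≤ 1 - 3 / 2 * (r ^ 2 / 16) := by
        have := diffMult_le (κ := 1 / 16) (by norm_num) hδ0 hr.le h2.le
          (le_trans (by gcongr) hδ4)
        linarith
      have hξ5 : |ξ| ≤ X + 5 := by
        rw [abs_le]; constructor <;> linarith
      have : |s * (ξ ^ p * realProd m₀ ξ * (S * q ^ N))| ≤ c := by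
        rw [habs, abs_of_nonneg hq0]
        calc |ξ| ^ p * |realProd m₀ ξ| * (|S| * q ^ N)
            ≤ (X + 5) ^ p * 1 * (1 * (1 - 3 / 2 * (r ^ 2 / 16)) ^ N) := by gcongr
          _ = c := by rw [hcdef]; ring
      linarith [(abs_le.1 this).1]
  · have h1 : v ∉ Set.Icc (-r) r := by
      intro h
      have := abs_le.2 h
      linarith
    have h2 : v ∉ Set.Icc (-4 : ℝ) 4 := by
      intro h
      have := abs_le.2 h
      linarith
    rw [Set.indicator_of_notMem h1, Set.indicator_of_notMem h2]
    by_cases hne : realProd m₀ ξ = 0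
    · rw [hne]; simp only [mul_zero, zero_mul, sub_zero, zero_sub]; linarith
    have hvξ : v = ξ - (X + 4 * r) := by rw [hξ]; ring
    have hfar := le_abs_sub_of_realProd_ne_zero hm hcoz hn (t := 4 * r) (by linarith)
      (by linarith) hne (by rwa [← hX, ← hvξ])
    rw [← hX, ← hvξ] at hfar
    have hv0 : v ≠ 0 := by rintro rfl; simp at h4; linarith
    have hw := far_weight_le (p := p) (by omega) hp (abs_nonneg ξ)
      (one_le_pow₀ one_le_two : (1 : ℝ) ≤ 2 ^ n)
      (abs_nonneg (Real.sinc (δ * v))) (abs_sinc_mul_le_inv hδ0 hv0) hfar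
    have hqa : |q| ≤ 1 + 4 * (N : ℝ) ^ 2 := by
      refine (abs_diffMult_le (by norm_num) v).trans (le_of_eq ?_)
      rw [hδ]; field_simp; ring
    have : |s * (ξ ^ p * realProd m₀ ξ * (S * q ^ N))| ≤ k * ((1 + |ξ|) ^ 2)⁻¹ := by
      rw [habs, hS, abs_pow]
      calc |ξ| ^ p * |realProd m₀ ξ| * (|Real.sinc (δ * v)| ^ (3 * N) * |q| ^ N)
          ≤ |ξ| ^ p * 1 * (|Real.sinc (δ * v)| ^ (3 * N) * (1 + 4 * (N : ℝ) ^ 2) ^ N) := by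
            gcongr
        _ = (|ξ| ^ p * |Real.sinc (δ * v)| ^ (3 * N)) * (1 + 4 * (N : ℝ) ^ 2) ^ N := by ring
        _ ≤ ((32 * N) ^ (3 * N) * ((2 ^ n) ^ N)⁻¹ * ((1 + |ξ|) ^ 2)⁻¹) *
            (1 + 4 * (N : ℝ) ^ 2) ^ N := by gcongr
        _ = _ := by rw [hkdef]; ring
    linarith [(abs_le.1 this).1]

/-- Local bounds on the `p`-th derivative of the scaling function control the product in the
`n`-th block. -/
theorem block_le_of_fourierInt_le (hm : IsLowPassFilter m₀)
    (hcoz : Function.support m₀ ∩ Set.Icc 0 π ⊆ Set.Ico 0 (4 * π / 5)) {r b B : ℝ} (hr : 0 < r)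
    (hr' : r ≤ 1 / 24) {n N p : ℕ} (hn : 4 ≤ n) (hN : 8 ≤ N) (hp : p ≤ N) (hb0 : 0 < b)
    (hb : ∀ u, 2 * r ≤ u → u ≤ 6 * r → b ≤ |realProd m₀ (2 ^ n * (2 * π / 3) + u)|)
    (hint : Integrable fun ξ => ξ ^ p * realProd m₀ ξ)
    (hB : ∀ y, |y| ≤ 1 → ‖fourierInt (fun ξ => ((ξ ^ p * realProd m₀ ξ : ℝ) : ℂ)) y‖ ≤ B) :
    r * (2 ^ n * (2 * π / 3)) ^ p * b * (1 - r ^ 2 / 16) ^ N ≤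
      (1 + 4 * (N : ℝ) ^ 2) ^ N * B +
      8 * ((2 ^ n * (2 * π / 3) + 5) ^ p * (1 - 3 / 2 * (r ^ 2 / 16)) ^ N) +
      (1 + 4 * (N : ℝ) ^ 2) ^ N * ((32 * N) ^ (3 * N) * ((2 ^ n) ^ N)⁻¹) *
        ∫ ξ : ℝ, ((1 + |ξ|) ^ 2)⁻¹ := by
  have hNpos : (0 : ℝ) < N := by exact_mod_cast (by omega : 0 < N)
  obtain ⟨s, hs, hsign⟩ := exists_sign_mul_eq_abs (x := 2 * r) (y := 6 * r)
    (f := fun u => realProd m₀ (2 ^ n * (2 * π / 3) + u))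
    ((continuous_realProd hm hcoz).comp (by fun_prop))
    (fun u h1 h2 h => by have := hb u h1 h2; rw [h, abs_zero] at this; linarith)
  have hpt := pointwise_lower_bound hm hcoz hr hr' hn hN hp hs hb0 hb hsign
  set X : ℝ := 2 ^ n * (2 * π / 3) with hX
  set z : ℝ := X + 4 * r with hz
  set δ : ℝ := 1 / (4 * N) with hδ
  have hδ0 : 0 < δ := by positivity
  set G : ℝ → ℝ := fun v => (v + z) ^ p * realProd m₀ (v + z) with hG
  set mult : ℝ → ℝ := fun v => Real.sinc (δ * v) ^ (3 * N) * diffMult (1 / 16) δ v ^ N with hmult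
  have hGint : Integrable G := hint.comp_add_right z
  have hGc : Integrable fun v => (G v : ℂ) := hGint.ofReal
  -- Recentring the frequency at z only modulates the Fourier integral, so its modulus is unchanged.
  have hshift : ∀ y, ‖fourierInt (fun v => (G v : ℂ)) y‖ =
      ‖fourierInt (fun ξ => ((ξ ^ p * realProd m₀ ξ : ℝ) : ℂ)) y‖ := by
    intro y
    unfold fourierInt
    beta_reduce
    rw [← integral_add_right_eq_self (fun ξ : ℝ => ((ξ ^ p * realProd m₀ ξ : ℝ) : ℂ) *
      Complex.exp (((y * ξ : ℝ) : ℂ) * Complex.I)) z]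
    have : ∀ v : ℝ, (((v + z) ^ p * realProd m₀ (v + z) : ℝ) : ℂ) *
        Complex.exp (((y * (v + z) : ℝ) : ℂ) * Complex.I) =
        Complex.exp (((y * z : ℝ) : ℂ) * Complex.I) *
          ((G v : ℂ) * Complex.exp (((y * v : ℝ) : ℂ) * Complex.I)) := by
      intro v
      rw [mul_left_comm, ← Complex.exp_add]
      congr 2
      push_cast
      ring
    rw [integral_congr_ae (ae_of_all _ this)]
    rw [integral_const_mul, norm_mul, Complex.norm_exp_ofReal_mul_I, one_mul]
  have hT := norm_integral_mul_multiplier_le (κ := 1 / 16) (M := 3 * N) (N := N) (B := B) hGc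
    (by norm_num) hδ0 (fun y hy => by
      rw [hshift]
      refine hB y (hy.trans (le_of_eq ?_))
      -- The total reach is (3N + N)·1/(4N) = 1.
      rw [hδ]; push_cast; field_simp; ring)
  have hmultc : Continuous mult := by
    have h1 : Continuous fun v => Real.sinc (δ * v) := Real.continuous_sinc.comp (by fun_prop)
    exact (h1.pow _).mul ((continuous_diffMult _ _).pow _)
  have hmultb : ∀ v, ‖mult v‖ ≤ 1 * (1 + 4 * (1 / 16) / δ ^ 2) ^ N := by
    intro v
    rw [hmult, norm_mul, norm_pow, norm_pow, Real.norm_eq_abs, Real.norm_eq_abs]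
    gcongr
    · exact pow_le_one₀ (abs_nonneg _) (Real.abs_sinc_le_one _)
    · exact abs_diffMult_le (by norm_num) v
  have hprod : Integrable fun v => G v * mult v :=
    hGint.mul_bdd hmultc.aestronglyMeasurable (ae_of_all _ hmultb)
  have hTr : ∫ v, (G v : ℂ) * ((mult v : ℝ) : ℂ) = ((∫ v, G v * mult v : ℝ) : ℂ) := by
    rw [← integral_complex_ofReal]
    congr 1
    ext v
    exact (Complex.ofReal_mul _ _).symm
  have hδ2 : 1 + 4 * (1 / 16) / δ ^ 2 = 1 + 4 * (N : ℝ) ^ 2 := by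
    rw [hδ]; field_simp; ring
  rw [hTr, Complex.norm_real, Real.norm_eq_abs, hδ2] at hT
  have hs1 : s * ∫ v, G v * mult v ≤ (1 + 4 * (N : ℝ) ^ 2) ^ N * B := by
    refine le_trans ?_ hT
    refine (le_abs_self _).trans (le_of_eq ?_)
    rw [abs_mul, hs, one_mul]
  set m : ℝ := X ^ p * b / 2 * (1 - r ^ 2 / 16) ^ N with hmdef
  set c : ℝ := (X + 5) ^ p * (1 - 3 / 2 * (r ^ 2 / 16)) ^ N with hcdef
  set k : ℝ := (1 + 4 * (N : ℝ) ^ 2) ^ N * ((32 * N) ^ (3 * N) * ((2 ^ n) ^ N)⁻¹) with hkdef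
  have i1 : Integrable ((Set.Icc (-r) r).indicator fun _ => m) :=
    (integrable_indicator_iff measurableSet_Icc).2 (by simp)
  have i2 : Integrable ((Set.Icc (-4 : ℝ) 4).indicator fun _ => c) :=
    (integrable_indicator_iff measurableSet_Icc).2 (by simp)
  have i3 : Integrable fun v : ℝ => k * ((1 + |v + z|) ^ 2)⁻¹ :=
    (integrable_one_add_abs_sq.comp_add_right z).const_mul k
  have hmono : ∫ v, ((Set.Icc (-r) r).indicator (fun _ => m) v
      - (Set.Icc (-4 : ℝ) 4).indicator (fun _ => c) v - k * ((1 + |v + z|) ^ 2)⁻¹) ≤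
      ∫ v, s * (G v * mult v) :=
    integral_mono ((i1.sub i2).sub i3) (hprod.const_mul s) hpt
  have e1 : ∫ v, ((Set.Icc (-r) r).indicator (fun _ => m) v
      - (Set.Icc (-4 : ℝ) 4).indicator (fun _ => c) v - k * ((1 + |v + z|) ^ 2)⁻¹) =
      ((∫ v, (Set.Icc (-r) r).indicator (fun _ => m) v)
      - ∫ v, (Set.Icc (-4 : ℝ) 4).indicator (fun _ => c) v) - ∫ v, k * ((1 + |v + z|) ^ 2)⁻¹ := by
    rw [← integral_sub i1 i2]
    exact integral_sub (i1.sub i2) i3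
  rw [e1, integral_const_mul s, integral_indicator measurableSet_Icc, integral_indicator measurableSet_Icc,
    setIntegral_const, setIntegral_const, integral_const_mul k,
    integral_add_right_eq_self (fun ξ : ℝ => ((1 + |ξ|) ^ 2)⁻¹) z] at hmono
  simp only [Measure.real, Real.volume_Icc, smul_eq_mul] at hmono
  rw [ENNReal.toReal_ofReal (by linarith), ENNReal.toReal_ofReal (by norm_num)] at hmono
  have hm2 : (r - -r) * m = r * X ^ p * b * (1 - r ^ 2 / 16) ^ N := by rw [hmdef]; ring
  rw [hm2] at hmono
  linarith

/-! ### Growth comparisons -/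

theorem eventually_log_mul_rpow_le (c₁ c₂ : ℝ) {e f ε : ℝ} (hef : e < f) (hε : 0 < ε) :
    ∀ᶠ n : ℕ in Filter.atTop, (c₁ + c₂ * Real.log n) * (n : ℝ) ^ e ≤ ε * (n : ℝ) ^ f := by
  have h1 : (fun x : ℝ => c₁ + c₂ * Real.log x) =o[Filter.atTop] fun x : ℝ => x ^ (f - e) := by
    refine Asymptotics.IsLittleO.add ?_ ?_
    · refine Asymptotics.isLittleO_const_left.2 (Or.inr ?_)
      exact Filter.tendsto_abs_atTop_atTop.comp (tendsto_rpow_atTop (by linarith))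
    · exact (isLittleO_log_rpow_atTop (by linarith)).const_mul_left c₂
  have h2 := (h1.bound hε).and (Filter.eventually_gt_atTop (0 : ℝ))
  filter_upwards [tendsto_natCast_atTop_atTop.eventually h2] with n hn
  obtain ⟨h3, h4⟩ := hn
  rw [Real.norm_eq_abs, Real.norm_of_nonneg (by positivity)] at h3
  calc (c₁ + c₂ * Real.log n) * (n : ℝ) ^ e
      ≤ (ε * (n : ℝ) ^ (f - e)) * (n : ℝ) ^ e := by
        gcongr
        exact (le_abs_self _).trans h3
    _ = ε * (n : ℝ) ^ f := by
        rw [mul_assoc, ← Real.rpow_add h4, sub_add_cancel]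

theorem ceil_rpow_bounds {n : ℕ} (hn : 1 ≤ n) {a : ℝ} (ha : 0 ≤ a) :
    (n : ℝ) ^ a ≤ ⌈(n : ℝ) ^ a⌉₊ ∧ (⌈(n : ℝ) ^ a⌉₊ : ℝ) ≤ 2 * (n : ℝ) ^ a := by
  have h1 : 1 ≤ (n : ℝ) ^ a := Real.one_le_rpow (by exact_mod_cast hn) ha
  refine ⟨Nat.le_ceil _, ?_⟩
  linarith [Nat.ceil_lt_add_one (by positivity : 0 ≤ (n : ℝ) ^ a)]

set_option maxHeartbeats 1000000 in
/-- The three growth comparisons that make the localization argument work. -/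
theorem eventually_exponents {A α K c τ a b s σ' : ℝ} (hA : 0 < A) (hα : 0 < α) (hK : 0 ≤ K)
    (hc : 0 ≤ c) (hτ : 0 < τ) (hσ' : 1 < σ') (ha : 0 < a) (has : a < s) (hsb : s < b)
    (hba : b < a + 1) (haσ : a * σ' < a + 1) :
    ∀ᶠ n : ℕ in Filter.atTop, ∀ N p : ℕ, N = ⌈(n : ℝ) ^ b⌉₊ → p = ⌈(n : ℝ) ^ a⌉₊ →
      (K + A * (n : ℝ) ^ s + N + 2 * N * Real.log (32 * N) + ((p : ℝ) ^ σ' + 1) * c +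
        τ * (p : ℝ) ^ σ' * Real.log p < p * n * Real.log 2) ∧
      (K + A * (n : ℝ) ^ s + 5 * p < α * N / 2) ∧
      (K + A * (n : ℝ) ^ s + N + 5 * N * Real.log (32 * N) < n * N * Real.log 2) := by
  have hb : 0 < b := by linarith
  -- The first comparison spends four shares of 1/10 against n^{a+1} log 2, the second three shares
  -- of α/8 against α/2, the third one share of 1/2 against log 2.
  have k1 := eventually_log_mul_rpow_le (K + c) 0 (by linarith : (0 : ℝ) < a + 1)
    (by norm_num : (0 : ℝ) < 1 / 10)
  have k2 := eventually_log_mul_rpow_le A 0 (by linarith : s < a + 1)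
    (by norm_num : (0 : ℝ) < 1 / 10)
  have k3 := eventually_log_mul_rpow_le (2 * (1 + 2 * Real.log 64)) (2 * (2 * b)) hba
    (by norm_num : (0 : ℝ) < 1 / 10)
  have k4 := eventually_log_mul_rpow_le (2 ^ σ' * (c + τ * Real.log 2)) (2 ^ σ' * (τ * a)) haσ
    (by norm_num : (0 : ℝ) < 1 / 10)
  have k5 := eventually_log_mul_rpow_le K 0 hb (by positivity : 0 < α / 8)
  have k6 := eventually_log_mul_rpow_le A 0 hsb (by positivity : 0 < α / 8)
  have k7 := eventually_log_mul_rpow_le 10 0 (by linarith : a < b) (by positivity : 0 < α / 8)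
  have k8 := eventually_log_mul_rpow_le (K + A + 1 + 5 * Real.log 64) (5 * b) zero_lt_one
    (by norm_num : (0 : ℝ) < 1 / 2)
  filter_upwards [k1, k2, k3, k4, k5, k6, k7, k8, Filter.eventually_ge_atTop 1]
    with n k1 k2 k3 k4 k5 k6 k7 k8 hn N p hN hp
  have hn1 : (1 : ℝ) ≤ n := by exact_mod_cast hn
  have hn0 : (0 : ℝ) < n := by linarith
  obtain ⟨hN1, hN2⟩ := ceil_rpow_bounds hn hb.le
  obtain ⟨hp1, hp2⟩ := ceil_rpow_bounds hn ha.le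
  rw [← hN] at hN1 hN2
  rw [← hp] at hp1 hp2
  have hl2 := Real.log_two_gt_d9
  have hln : 0 ≤ Real.log n := Real.log_nonneg hn1
  have hxb : 1 ≤ (n : ℝ) ^ b := Real.one_le_rpow hn1 hb.le
  have hxa : 1 ≤ (n : ℝ) ^ a := Real.one_le_rpow hn1 ha.le
  have hxsb : (n : ℝ) ^ s ≤ (n : ℝ) ^ b := Real.rpow_le_rpow_of_exponent_le hn1 hsb.le
  have hNpos : (0 : ℝ) < N := by linarith
  have hppos : (0 : ℝ) < p := by linarith
  have hlogN : Real.log (32 * N) ≤ Real.log 64 + b * Real.log n := by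
    rw [← Real.log_rpow hn0, ← Real.log_mul (by norm_num) (by positivity)]
    exact Real.log_le_log (by positivity) (by linarith)
  have hlogN0 : 0 ≤ Real.log (32 * N) := Real.log_nonneg (by linarith)
  have hlogp : Real.log p ≤ Real.log 2 + a * Real.log n := by
    rw [← Real.log_rpow hn0, ← Real.log_mul (by norm_num) (by positivity)]
    exact Real.log_le_log (by positivity) (by linarith)
  have hlogp0 : 0 ≤ Real.log p := Real.log_nonneg (by linarith)
  have hpσ : (p : ℝ) ^ σ' ≤ 2 ^ σ' * (n : ℝ) ^ (a * σ') := by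
    rw [Real.rpow_mul hn0.le, ← Real.mul_rpow (by norm_num) (by positivity)]
    exact Real.rpow_le_rpow hppos.le hp2 (by linarith)
  have hxa1 : (n : ℝ) ^ (a + 1) = n ^ a * n := by rw [Real.rpow_add hn0, Real.rpow_one]
  simp only [zero_mul, add_zero, Real.rpow_zero, mul_one, Real.rpow_one] at k1 k2 k5 k6 k7 k8
  refine ⟨?_, ?_, ?_⟩
  · have t3 : (N : ℝ) + 2 * N * Real.log (32 * N) ≤ 1 / 10 * (n : ℝ) ^ (a + 1) := by
      calc (N : ℝ) + 2 * N * Real.log (32 * N) = N * (1 + 2 * Real.log (32 * N)) := by ring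
        _ ≤ (2 * (n : ℝ) ^ b) * (1 + 2 * (Real.log 64 + b * Real.log n)) := by gcongr
        _ = (2 * (1 + 2 * Real.log 64) + 2 * (2 * b) * Real.log n) * (n : ℝ) ^ b := by ring
        _ ≤ _ := k3
    have t4 : (p : ℝ) ^ σ' * c + τ * (p : ℝ) ^ σ' * Real.log p ≤ 1 / 10 * (n : ℝ) ^ (a + 1) := by
      calc (p : ℝ) ^ σ' * c + τ * (p : ℝ) ^ σ' * Real.log p
          = (p : ℝ) ^ σ' * (c + τ * Real.log p) := by ring
        _ ≤ (2 ^ σ' * (n : ℝ) ^ (a * σ')) * (c + τ * (Real.log 2 + a * Real.log n)) := by gcongr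
        _ = (2 ^ σ' * (c + τ * Real.log 2) + 2 ^ σ' * (τ * a) * Real.log n) *
            (n : ℝ) ^ (a * σ') := by ring
        _ ≤ _ := k4
    have t5 : (n : ℝ) ^ (a + 1) * (1 / 2) < p * n * Real.log 2 := by
      rw [hxa1]
      have h1 : (n : ℝ) ^ a * n ≤ p * n := by gcongr
      have h2 : (0 : ℝ) < (n : ℝ) ^ a * n := by positivity
      have h3 := mul_le_mul_of_nonneg_right h1 (by linarith : 0 ≤ Real.log 2)
      have h4 := mul_lt_mul_of_pos_left (by linarith : 1 / 2 < Real.log 2) h2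
      linarith
    have : (0 : ℝ) < (n : ℝ) ^ (a + 1) := by positivity
    linarith
  · have : α * (n : ℝ) ^ b ≤ α * N := by gcongr
    have : 0 < α * (n : ℝ) ^ b := by positivity
    linarith
  · have h1 : K ≤ K * N := le_mul_of_one_le_right hK (by linarith)
    have h2 : A * (n : ℝ) ^ s ≤ A * N := by gcongr; linarith
    have h3 : (N : ℝ) * Real.log (32 * N) ≤ N * (Real.log 64 + b * Real.log n) := by gcongr
    calc K + A * (n : ℝ) ^ s + N + 5 * N * Real.log (32 * N)
        ≤ N * (K + A + 1 + 5 * Real.log 64 + 5 * b * Real.log n) := by linarith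
      _ ≤ N * (1 / 2 * n) := by gcongr
      _ < N * (Real.log 2 * n) := by gcongr; linarith
      _ = _ := by ring

/-! ### Failure of higher regularity -/

theorem norm_fourierInt_eq {g : ℝ → ℝ} (hg : ∀ p : ℕ, Integrable fun ξ => ξ ^ p * g ξ) (p : ℕ)
    (y : ℝ) : ‖fourierInt (fun ξ => ((ξ ^ p * g ξ : ℝ) : ℂ)) y‖ =
      2 * π * ‖iteratedDeriv p (𝓕 fun w : ℝ => (g (2 * π * w) : ℂ)) (-y)‖ := by
  rw [iteratedDeriv_fourier_comp hg, norm_mul, norm_mul, norm_pow, norm_neg, Complex.norm_I,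
    one_pow, one_mul, Complex.norm_real, Real.norm_of_nonneg (by positivity), ← mul_assoc,
    mul_inv_cancel₀ (by positivity), one_mul, neg_neg]
  rfl

set_option maxHeartbeats 1000000 in
-- Assuming regularity of order σ', all three error terms of `block_le_of_fourierInt_le` become less
-- than a third of the main term for one large n.
theorem not_memExtGevrey_fourier_realProd (hm : IsLowPassFilter m₀)
    (hcoz : Function.support m₀ ∩ Set.Icc 0 π ⊆ Set.Ico 0 (4 * π / 5)) {θ σ' r A : ℝ}
    (hθ : 0 < θ) (hσ' : 1 < σ') (hθσ : θ < 1 / (σ' - 1))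
    (hint : ∀ p : ℕ, Integrable fun ξ => ξ ^ p * realProd m₀ ξ) (hr : 0 < r) (hr' : r ≤ 1 / 24)
    (hA : 0 < A)
    (hlow : ∀ n : ℕ, 1 ≤ n → ∀ u, 2 * r ≤ u → u ≤ 6 * r →
      Real.exp (-A * (n : ℝ) ^ (1 + θ)) ≤ |realProd m₀ (2 ^ n * (2 * π / 3) + u)|) :
    ¬ MemExtGevrey σ' (𝓕 fun w : ℝ => (realProd m₀ (2 * π * w) : ℂ)) := by
  rintro ⟨τ, hτ, -, hK⟩
  obtain ⟨C, hC, hder⟩ := hK (Set.Icc (-1) 1) isCompact_Icc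
  have hs : 0 < σ' - 1 := by linarith
  -- The choice a > θ leaves room for b in (1+θ, a+1), and a < 1/(σ'-1) means aσ' < a+1.
  obtain ⟨a, ha1, ha2⟩ := exists_between (lt_min (by linarith : θ < 1 + θ) hθσ)
  have haσ : a * σ' < a + 1 := by
    have := lt_of_lt_of_le ha2 (min_le_right _ _)
    rw [lt_div_iff₀ hs] at this
    linarith
  have has : a < 1 + θ := lt_of_lt_of_le ha2 (min_le_left _ _)
  have ha : 0 < a := hθ.trans ha1
  obtain ⟨b, hb1, hb2⟩ := exists_between (by linarith : 1 + θ < a + 1)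
  set I : ℝ := ∫ ξ : ℝ, ((1 + |ξ|) ^ 2)⁻¹ with hI
  have hI0 : 0 ≤ I := integral_nonneg fun ξ => by positivity
  -- The factor e^K absorbs all fixed constants, including the integral I and 1/r.
  set K : ℝ := max 0 (Real.log (24 * (π + I) / r)) with hKdef
  have hK0 : 0 ≤ K := le_max_left _ _
  have hπ := Real.pi_gt_three
  have hKexp : 24 * (π + I) ≤ r * Real.exp K := by
    have h1 := Real.exp_le_exp.2 (le_max_right 0 (Real.log (24 * (π + I) / r)))
    rw [Real.exp_log (by positivity), div_le_iff₀ hr] at h1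
    linarith
  set α : ℝ := r ^ 2 / 16 with hα
  have hα0 : 0 < α := by positivity
  have hα1 : α ≤ 1 / 2 := by rw [hα]; nlinarith
  obtain ⟨n, hn, hn8⟩ := ((eventually_exponents hA hα0 hK0 (abs_nonneg (Real.log C)) hτ hσ' ha has
    hb1 hb2 haσ).and (Filter.eventually_ge_atTop 8)).exists
  set N := ⌈(n : ℝ) ^ b⌉₊ with hN
  set p := ⌈(n : ℝ) ^ a⌉₊ with hp
  obtain ⟨c1, c2, c3⟩ := hn N p rfl rfl
  have hn1 : (1 : ℝ) ≤ n := by exact_mod_cast (by omega : 1 ≤ n)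
  have hpN : p ≤ N := Nat.ceil_mono (Real.rpow_le_rpow_of_exponent_le hn1 (by linarith))
  have hN8 : 8 ≤ N := by
    have h1 : (n : ℝ) ^ (1 : ℝ) ≤ (n : ℝ) ^ b := Real.rpow_le_rpow_of_exponent_le hn1 (by linarith)
    rw [Real.rpow_one] at h1
    have h2 : (n : ℝ) ≤ N := h1.trans (Nat.le_ceil _)
    have : n ≤ N := by exact_mod_cast h2
    omega
  have hp0 : p ≠ 0 := by
    have : 0 < p := Nat.ceil_pos.2 (by positivity)
    omega
  have hN0 : (8 : ℝ) ≤ N := by exact_mod_cast hN8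
  have hppos : (0 : ℝ) < p := by exact_mod_cast Nat.pos_of_ne_zero hp0
  set E := Real.exp (-A * (n : ℝ) ^ (1 + θ)) with hE
  set B : ℝ := 2 * π * (C ^ ((p : ℝ) ^ σ' + 1) * gevreySeq τ σ' p) with hB
  have hBp : ∀ y, |y| ≤ 1 → ‖fourierInt (fun ξ => ((ξ ^ p * realProd m₀ ξ : ℝ) : ℂ)) y‖ ≤ B := by
    intro y hy
    rw [norm_fourierInt_eq hint]
    have := hder p (-y) (by rw [abs_le] at hy; constructor <;> linarith)
    exact mul_le_mul_of_nonneg_left this (by positivity)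
  have hmain := block_le_of_fourierInt_le hm hcoz hr hr' (by omega) hN8 hpN (Real.exp_pos _)
    (hlow n (by omega)) (hint p) hBp
  rw [← hI, ← hα, ← hE] at hmain
  set X : ℝ := 2 ^ n * (2 * π / 3) with hX
  have hXn : 2 ^ n ≤ X := by
    rw [hX]; exact le_mul_of_one_le_right (by positivity) (by linarith)
  have hX1 : 1 ≤ X := (one_le_pow₀ one_le_two).trans hXn
  set S := r * X ^ p * E * (1 - α) ^ N with hS
  have hEexp : ∀ z : ℝ, Real.exp (K + A * (n : ℝ) ^ (1 + θ) + z) * E = Real.exp K * Real.exp z := by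
    intro z
    rw [hE, ← Real.exp_add, ← Real.exp_add]
    congr 1
    ring
  have hαN : Real.exp (-N) ≤ (1 - α) ^ N := by
    have h1 : Real.exp (-1) ≤ 1 - α := by
      have : Real.exp (-1) ≤ 1 / 2 := by
        rw [Real.exp_neg, one_div]
        exact inv_anti₀ (by norm_num) (by linarith [Real.add_one_le_exp (1 : ℝ)])
      linarith
    calc Real.exp (-N) = Real.exp (-1) ^ N := by rw [← Real.exp_nat_mul]; congr 1; ring
      _ ≤ _ := pow_le_pow_left₀ (Real.exp_pos _).le h1 N
  have hq : (1 + 4 * (N : ℝ) ^ 2) ^ N ≤ Real.exp (2 * N * Real.log (32 * N)) := by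
    calc (1 + 4 * (N : ℝ) ^ 2) ^ N ≤ ((32 * N) ^ 2) ^ N := by gcongr; nlinarith
      _ = Real.exp (2 * N * Real.log (32 * N)) := by
        rw [← pow_mul, ← Real.rpow_natCast, Real.rpow_def_of_pos (by positivity)]
        congr 1; push_cast; ring
  -- The derivative bound loses to X^p ≥ 2^{np}.
  have E1 : (1 + 4 * (N : ℝ) ^ 2) ^ N * B < S / 3 := by
    have hB' : C ^ ((p : ℝ) ^ σ' + 1) * gevreySeq τ σ' p ≤
        Real.exp (((p : ℝ) ^ σ' + 1) * |Real.log C| + τ * (p : ℝ) ^ σ' * Real.log p) := by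
      rw [gevreySeq, if_neg hp0, Real.rpow_def_of_pos hC, Real.rpow_def_of_pos hppos (τ * (p : ℝ) ^ σ'),
        ← Real.exp_add]
      apply Real.exp_le_exp.2
      have : Real.log C * ((p : ℝ) ^ σ' + 1) ≤ ((p : ℝ) ^ σ' + 1) * |Real.log C| := by
        rw [mul_comm]; gcongr; exact le_abs_self _
      linarith
    have hXp : Real.exp (p * n * Real.log 2) ≤ X ^ p := by
      calc Real.exp (p * n * Real.log 2) = (2 ^ n) ^ p := by
            rw [mul_assoc, Real.exp_nat_mul, Real.exp_nat_mul, Real.exp_log two_pos]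
        _ ≤ _ := by gcongr
    set z := (N : ℝ) + 2 * N * Real.log (32 * N) + (((p : ℝ) ^ σ' + 1) * |Real.log C| +
      τ * (p : ℝ) ^ σ' * Real.log p) with hz
    calc (1 + 4 * (N : ℝ) ^ 2) ^ N * B
        ≤ Real.exp (2 * N * Real.log (32 * N)) * (2 * π *
          Real.exp (((p : ℝ) ^ σ' + 1) * |Real.log C| + τ * (p : ℝ) ^ σ' * Real.log p)) :=
          mul_le_mul hq (mul_le_mul_of_nonneg_left hB' (by positivity))
            ((norm_nonneg _).trans (hBp 0 (by simp))) (Real.exp_pos _).le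
      _ = 2 * π * (Real.exp z * Real.exp (-N)) := by
          rw [mul_left_comm, ← Real.exp_add, ← Real.exp_add, hz]
          congr 2
          ring
      _ ≤ (r * Real.exp K / 12) * (Real.exp z * Real.exp (-N)) := by gcongr; linarith
      _ = r / 12 * (Real.exp (K + A * (n : ℝ) ^ (1 + θ) + z) * E) * Real.exp (-N) := by
          rw [hEexp]; ring
      _ ≤ r / 12 * (X ^ p * E) * (1 - α) ^ N := by
          gcongr
          exact (Real.exp_le_exp.2 (by linarith)).trans hXp
      _ < S / 3 := by
          have : 0 < S := by have := (Real.exp_pos (-(N : ℝ))).trans_le hαN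
                             positivity
          linarith
  -- The gap between 1 - α and 1 - 3α/2 gives e^{-αN/2}, which beats both 1/E and the loss e^{5p}
  -- from replacing X by X + 5.
  have E2 : 8 * ((X + 5) ^ p * (1 - 3 / 2 * α) ^ N) < S / 3 := by
    have h1 : (X + 5) ^ p ≤ X ^ p * Real.exp (5 * p) := by
      have : X + 5 ≤ X * Real.exp 5 := by nlinarith [Real.add_one_le_exp (5 : ℝ)]
      calc (X + 5) ^ p ≤ (X * Real.exp 5) ^ p := by gcongr
        _ = _ := by rw [mul_pow, ← Real.exp_nat_mul, mul_comm (p : ℝ)]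
    have h2 : (1 - 3 / 2 * α) ^ N ≤ (1 - α) ^ N * Real.exp (-(α * N / 2)) := by
      have : 1 - 3 / 2 * α ≤ (1 - α) * Real.exp (-(α / 2)) := by
        nlinarith [Real.add_one_le_exp (-(α / 2))]
      calc (1 - 3 / 2 * α) ^ N ≤ ((1 - α) * Real.exp (-(α / 2))) ^ N :=
            pow_le_pow_left₀ (by linarith) this N
        _ = _ := by rw [mul_pow, ← Real.exp_nat_mul]; congr 2; ring
    have h0 : 0 < (1 - α) ^ N := pow_pos (by linarith) N
    calc 8 * ((X + 5) ^ p * (1 - 3 / 2 * α) ^ N)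
        ≤ 8 * ((X ^ p * Real.exp (5 * p)) * ((1 - α) ^ N * Real.exp (-(α * N / 2)))) := by
          have : 0 ≤ (1 - 3 / 2 * α) ^ N := pow_nonneg (by linarith) N
          gcongr
      _ = 8 * (X ^ p * (1 - α) ^ N) * Real.exp (5 * p - α * N / 2) := by
          rw [sub_eq_add_neg (5 * (p : ℝ)), Real.exp_add]; ring
      _ ≤ (r * Real.exp K / 9) * (X ^ p * (1 - α) ^ N) * Real.exp (5 * p - α * N / 2) := by
          gcongr; linarith
      _ = r / 9 * (X ^ p * (1 - α) ^ N) *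
          (Real.exp (K + A * (n : ℝ) ^ (1 + θ) + (5 * p - α * N / 2)) * E) := by
          rw [hEexp]; ring
      _ ≤ r / 9 * (X ^ p * (1 - α) ^ N) * (1 * E) := by
          gcongr
          exact Real.exp_le_one_iff.2 (by linarith)
      _ < S / 3 := by
          have : 0 < S := by positivity
          linarith
  -- The other blocks carry 2^{-nN}, which beats N^{5N} and 1/E.
  have E3 : (1 + 4 * (N : ℝ) ^ 2) ^ N * ((32 * N) ^ (3 * N) * ((2 ^ n) ^ N)⁻¹) * I < S / 3 := by
    have h1 : ((32 : ℝ) * N) ^ (3 * N) = Real.exp (3 * N * Real.log (32 * N)) := by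
      rw [← Real.rpow_natCast, Real.rpow_def_of_pos (by positivity)]
      congr 1; push_cast; ring
    have h2 : (((2 : ℝ) ^ n) ^ N)⁻¹ = Real.exp (-(n * N * Real.log 2)) := by
      rw [Real.exp_neg, ← pow_mul, ← Real.rpow_natCast, Real.rpow_def_of_pos two_pos]
      congr 2; push_cast; ring
    set z := (N : ℝ) + 5 * N * Real.log (32 * N) - n * N * Real.log 2 with hz
    rw [h1, h2]
    calc (1 + 4 * (N : ℝ) ^ 2) ^ N * (Real.exp (3 * N * Real.log (32 * N)) *
          Real.exp (-(n * N * Real.log 2))) * I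
        ≤ Real.exp (2 * N * Real.log (32 * N)) * (Real.exp (3 * N * Real.log (32 * N)) *
          Real.exp (-(n * N * Real.log 2))) * I := by gcongr
      _ = Real.exp z * Real.exp (-N) * I := by
          rw [← Real.exp_add, ← Real.exp_add, ← Real.exp_add]
          congr 2
          rw [hz]; ring
      _ ≤ Real.exp z * Real.exp (-N) * (r * Real.exp K / 24) := by gcongr; linarith
      _ = r / 24 * 1 * (Real.exp (K + A * (n : ℝ) ^ (1 + θ) + z) * E) * Real.exp (-N) := by
          rw [hEexp]; ring
      _ ≤ r / 24 * X ^ p * (1 * E) * (1 - α) ^ N := by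
          gcongr
          · exact one_le_pow₀ hX1
          · exact Real.exp_le_one_iff.2 (by linarith)
      _ < S / 3 := by
          have : 0 < S := by have := (Real.exp_pos (-(N : ℝ))).trans_le hαN
                             positivity
          linarith
  linarith

/-! ### The threshold exponent and the identification of the scaling function. -/

theorem sigmaEta_sub_one {σ η : ℝ} (hσ : 1 < σ) (hη : 1 < η) :
    sigmaEta σ η - 1 = (σ - 1) / (1 + η * (σ - 1)) := by
  have : 0 < 1 + η * (σ - 1) := by nlinarith
  unfold sigmaEta
  field_simp
  ring

theorem sigmaEta_mem {σ η : ℝ} (hσ : 1 < σ) (hη : 1 < η) :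
    sigmaEta σ η ∈ Set.Ioo 1 (min 2 σ) := by
  have h := sigmaEta_sub_one hσ hη
  have hs : 0 < σ - 1 := by linarith
  have h0 : 0 < 1 + η * (σ - 1) := by nlinarith
  have h1 : 0 < (σ - 1) / (1 + η * (σ - 1)) := by positivity
  have h2 : (σ - 1) / (1 + η * (σ - 1)) < 1 := by
    rw [div_lt_one h0]; nlinarith
  have h3 : (σ - 1) / (1 + η * (σ - 1)) < σ - 1 := by
    rw [div_lt_iff₀ h0]
    have := mul_pos (by linarith : 0 < η) hs
    exact lt_mul_of_one_lt_right hs (by linarith)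
  refine ⟨by linarith, lt_min (by linarith) (by linarith)⟩

/-- At η = 1 the two thresholds coincide, because 1 + (σ-1) = σ; the slack is a positive multiple of
η - 1. -/
theorem lt_one_div_of_lt_sigmaEta {σ η σ' : ℝ} (hσ : 1 < σ) (hη : 1 < η) (hσ' : 1 < σ')
    (h : σ' < sigmaEta σ η) : σ / (σ - 1) < 1 / (σ' - 1) := by
  have hs : 0 < σ - 1 := by linarith
  have hs' : 0 < σ' - 1 := by linarith
  have h0 : 0 < 1 + η * (σ - 1) := by nlinarith
  have h1 : σ' - 1 < (σ - 1) / (1 + η * (σ - 1)) := by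
    rw [← sigmaEta_sub_one hσ hη]; linarith
  rw [lt_div_iff₀ h0] at h1
  rw [div_lt_div_iff₀ hs hs']
  linarith [mul_pos (mul_pos hs hs') (by linarith : 0 < η - 1)]

/-- The scaling function agrees almost everywhere with the Fourier integral of the product. -/
theorem ae_eq_fourier_realProd (hm : IsLowPassFilter m₀) {φ : Lp ℂ 2 (volume : Measure ℝ)}
    (hφ : IsScalingFunction m₀ φ) (hint : ∀ p : ℕ, Integrable fun ξ => ξ ^ p * realProd m₀ ξ) :
    φ =ᵐ[volume] 𝓕 fun w : ℝ => (realProd m₀ (2 * π * w) : ℂ) := by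
  have hπ : 2 * π ≠ 0 := by positivity
  have h1 : (𝓕 φ : Lp ℂ 2 (volume : Measure ℝ)) =ᵐ[volume]
      fun w : ℝ => (realProd m₀ (2 * π * w) : ℂ) := by
    have hq : Measure.QuasiMeasurePreserving (fun w : ℝ => 2 * π * w) volume volume := by
      refine ⟨by fun_prop, ?_⟩
      rw [Real.map_volume_mul_left hπ]
      exact Measure.smul_absolutelyContinuous
    filter_upwards [hq.ae hφ] with w hw
    rw [fourierHat, mul_div_cancel_left₀ _ hπ] at hw
    exact hw
  have h2 : Integrable fun w : ℝ => (realProd m₀ (2 * π * w) : ℂ) := by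
    simpa using integrable_pow_mul_comp hint 0
  refine (ae_eq_fourierInv_of_fourier_ae_eq φ h2 h1).trans (Filter.Eventually.of_forall fun x => ?_)
  -- The product is even, so its direct and inverse transforms agree.
  rw [Real.fourierInv_eq_fourier_comp_neg]
  simp only [mul_neg, realProd_neg hm]

end LowPass

end

theorem theorem3p2 (σ : ℝ) (hσ : 1 < σ) (m₀ : ℝ → ℝ) (hm : LowPass.IsLowPassFilter m₀)
    (hcoz : Function.support m₀ ∩ Set.Icc 0 Real.pi ⊆ Set.Ico 0 (4 * Real.pi / 5))
    (φ : MeasureTheory.Lp ℂ 2 (MeasureTheory.volume : MeasureTheory.Measure ℝ))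
    (hφ : LowPass.IsScalingFunction m₀ φ)
    (hbound : ∃ ε > 0, ∃ C₀ > 0, ∃ C₁ > 0, ∃ ρ₀ > 0, ∃ ρ₁ > 0,
      ∀ ξ ∈ Set.Icc (2 * Real.pi / 3 - ε) (2 * Real.pi / 3 + ε),
        C₁ * LowPass.ffun ρ₁ σ (ξ - 2 * Real.pi / 3) ≤ |m₀ ξ| ∧
        |m₀ ξ| ≤ C₀ * LowPass.ffun ρ₀ σ (ξ - 2 * Real.pi / 3)) :
    ∀ η : ℝ, 1 < η →
      LowPass.sigmaEta σ η ∈ Set.Ioo 1 (min 2 σ) ∧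
      (LowPass.AEMemGamma σ (LowPass.fourierHat φ) ∧
        ∀ σ' : ℝ, 1 < σ' → σ' < LowPass.sigmaEta σ η →
          ¬ LowPass.AEMemGamma σ' (LowPass.fourierHat φ)) ∧
      (LowPass.AEMemExtGevrey σ φ ∧
        ∀ σ' : ℝ, 1 < σ' → σ' < LowPass.sigmaEta σ η →
          ¬ LowPass.AEMemExtGevrey σ' φ) := by
  intro η hη
  obtain ⟨ε, hε, C₀, hC₀, C₁, hC₁, ρ₀, hρ₀, ρ₁, hρ₁, hb⟩ := hbound
  have hb' : ∀ v, |v| ≤ ε → C₁ * LowPass.ffun ρ₁ σ v ≤ |m₀ (2 * π / 3 + v)| ∧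
      |m₀ (2 * π / 3 + v)| ≤ C₀ * LowPass.ffun ρ₀ σ v := by
    intro v hv
    rw [abs_le] at hv
    have := hb (2 * π / 3 + v) ⟨by linarith, by linarith⟩
    rwa [add_sub_cancel_left] at this
  -- The upper bound at the centre reads |m₀| ≤ C₀ · 0, since `ffun` takes the value 0 there.
  have hzero : m₀ (2 * π / 3) = 0 := by
    have := (hb' 0 (by simpa using hε.le)).2
    simpa [LowPass.ffun] using this
  obtain ⟨ρ, hρ, C, hC, hdec⟩ := LowPass.exists_decay_realProd hm hcoz hσ hε hC₀ hρ₀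
    fun v hv => (hb' v hv).2
  have hcont := LowPass.continuous_realProd hm hcoz
  have hint := LowPass.integrable_pow_mul_of_decay hσ hρ hC hcont hdec
  obtain ⟨r, hr, hr', A, hA, hlow⟩ := LowPass.exists_lower_bound_realProd hm hcoz hσ hε hC₁ hρ₁
    hzero fun v hv => (hb' v hv).1
  have hnot : ∀ σ' : ℝ, 1 < σ' → σ' < LowPass.sigmaEta σ η →
      ¬ LowPass.MemExtGevrey σ' (𝓕 fun w : ℝ => (LowPass.realProd m₀ (2 * π * w) : ℂ)) :=
    fun σ' h1 h2 => LowPass.not_memExtGevrey_fourier_realProd hm hcoz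
      (div_pos (by linarith) (by linarith)) h1 (LowPass.lt_one_div_of_lt_sigmaEta hσ hη h1 h2)
      hint hr hr' hA hlow
  have hcontC : Continuous (LowPass.filterProd m₀) := Complex.continuous_ofReal.comp hcont
  have hnorm : ∀ ξ, ‖LowPass.filterProd m₀ ξ‖ = |LowPass.realProd m₀ ξ| := fun ξ => by
    rw [LowPass.filterProd_eq_ofReal, Complex.norm_real, Real.norm_eq_abs]
  have hφF := LowPass.ae_eq_fourier_realProd hm hφ hint
  refine ⟨LowPass.sigmaEta_mem hσ hη, ⟨?_, ?_⟩, ?_, ?_⟩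
  · exact ⟨LowPass.filterProd m₀, hφ, hcontC, ρ, hρ, C, hC, fun ξ => by
      rw [hnorm]; exact hdec ξ⟩
  · rintro σ' h1 h2 ⟨G, hG, hGc, ρ', hρ', C', hC', hGb⟩
    have hGeq : LowPass.filterProd m₀ = G :=
      (Continuous.ae_eq_iff_eq volume hcontC hGc).1 (hφ.symm.trans hG)
    -- Faster decay of the product would make its Fourier integral belong to ℰ_{σ'}, which is
    -- already excluded.
    refine hnot σ' h1 h2 (LowPass.memExtGevrey_of_decay h1 hρ' hC' hcont fun ξ => ?_)
    rw [← hnorm, hGeq]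
    exact hGb ξ
  · exact ⟨_, hφF, LowPass.memExtGevrey_of_decay hσ hρ hC hcont hdec⟩
  · rintro σ' h1 h2 ⟨h, hh, hmem⟩
    have heq : (𝓕 fun w : ℝ => (LowPass.realProd m₀ (2 * π * w) : ℂ)) = h := by
      obtain ⟨τ, -, hcd, -⟩ := hmem
      exact (Continuous.ae_eq_iff_eq volume (LowPass.contDiff_fourier_comp hint).continuous
        hcd.continuous).1 (hφF.symm.trans hh)
    exact hnot σ' h1 h2 (heq ▸ hmem)
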